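/- Let $X$ be a Calabi–Yau threefold, i.e. a connected, smooth projective complex threefold (regarded as a compact complex manifold) with trivial canonical bundle and without nonzero holomorphic $p$-forms for $p=1,2$. Let $g$ be an automorphism (biholomorphic self-map) of $X$ of order $2$ whose fixed locus $\operatorname{Fix}(g)$ is not empty, and assume that $g$ is small, i.e. that for each element $h$ of the group generated by $g$ and each $P\in\operatorname{Fix}(h)$ the differential $d_Ph\colon T_PX\to T_PX$ is not a quasi-reflection (that is, $\operatorname{rk}(d_Ph-\mathrm{id})\neq 1$). Then the following conditions are equivalent: 1. $g$ is symplectic, i.e. $g^*$ acts as the identity on $H^{0,3}(X)$, the subspace of $H^3(X,\mathbb{C})$ of the classes of closed smooth forms of type $(0,3)$; 2. $\operatorname{Fix}(g)$ contains a curve, i.e. an irreducible closed analytic subset of dimension $1$ of $X$; 3. $\operatorname{Fix}(g)$ is smooth of pure dimension $1$, i.e. near each of its points it is a complex submanifold of dimension $1$. -/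

import Mathlib

open scoped Manifold ContDiff LinearAlgebra.Projectivization

noncomputable section

namespace CYThreefold

/-- The model space `ℂ³` of a complex threefold. -/
abbrev Model : Type := Fin 3 → ℂ

section Forms

variable (𝕜 : Type*) [NontriviallyNormedField 𝕜] [NormedAlgebra 𝕜 ℂ]

/-- Differential forms of degree `p` on a complex threefold `X` (without regularity condition): an
alternating `𝕜`-multilinear form with complex values on each tangent space. For `𝕜 = ℝ` these are
the complex-valued forms on the underlying real manifold of dimension `6`, for `𝕜 = ℂ` the forms
of type `(p, 0)`. -/
abbrev Form (X : Type*) [TopologicalSpace X] [ChartedSpace Model X] (p : ℕ) : Type _ :=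
  (x : X) → (TangentSpace 𝓘(𝕜, Model) x) [⋀^Fin p]→L[𝕜] ℂ

variable {𝕜} {X : Type*} [TopologicalSpace X] [ChartedSpace Model X]

/-- The expression of a form in the coordinates of `e`, i.e. its pullback to `e.target` along
the inverse of `e`. -/
def Form.inCoordinates {p : ℕ} (α : Form 𝕜 X p) (e : OpenPartialHomeomorph X Model) :
    Model → Model [⋀^Fin p]→L[𝕜] ℂ := fun y =>
  (α (e.symm y)).compContinuousLinearMap (mfderiv 𝓘(𝕜, Model) 𝓘(𝕜, Model) e.symm y)

/-- The pullback `g^*α` of a form under a self-map `g`. -/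
def Form.pullback {p : ℕ} (g : X → X) (α : Form 𝕜 X p) : Form 𝕜 X p := fun x =>
  (α (g x)).compContinuousLinearMap (mfderiv 𝓘(𝕜, Model) 𝓘(𝕜, Model) g x)

/-- A form of type `(p, 0)` is holomorphic if it is so in every chart of the atlas. -/
def Form.IsHolomorphic {p : ℕ} (α : Form ℂ X p) : Prop :=
  ∀ e ∈ atlas Model X, DifferentiableOn ℂ (α.inCoordinates e) e.target

/-- A complex-valued form is smooth if it is so in every chart of the atlas. -/
def Form.IsSmooth {p : ℕ} (α : Form ℝ X p) : Prop :=
  ∀ e ∈ atlas Model X, ContDiffOn ℝ ∞ (α.inCoordinates e) e.target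

/-- `dβ = α`, where the exterior derivative is computed in the charts of the atlas. -/
def Form.HasExtDeriv {p : ℕ} (β : Form ℝ X p) (α : Form ℝ X (p + 1)) : Prop :=
  ∀ e ∈ atlas Model X, ∀ y ∈ e.target,
    extDeriv (β.inCoordinates e) y = α.inCoordinates e y

/-- A complex-valued form is of type `(0, p)` if it is conjugate linear in each argument. -/
def Form.IsAntiType {p : ℕ} (α : Form ℝ X p) : Prop :=
  ∀ (x : X) (v : Fin p → Model) (i : Fin p),
    α x (Function.update v i (Complex.I • v i) : Fin p → Model) = -Complex.I * α x v

/-- `α` represents a class in `H^{0,p}(X)`, the subspace of the de Rham cohomology `H^p(X, ℂ)` of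
all classes of closed smooth forms of type `(0, p)`. -/
def Form.RepresentsH0 {p : ℕ} (α : Form ℝ X p) : Prop :=
  α.IsSmooth ∧ α.HasExtDeriv 0 ∧ α.IsAntiType

/-- Two forms of degree `p + 1` have the same de Rham class if they differ by the exterior
derivative of a smooth form of degree `p`. -/
def Form.IsCohomologous {p : ℕ} (α α' : Form ℝ X (p + 1)) : Prop :=
  ∃ β : Form ℝ X p, β.IsSmooth ∧ β.HasExtDeriv (α - α')

end Forms

section Geometry

variable {X : Type*} [TopologicalSpace X] [ChartedSpace Model X]

variable (X) in
/-- `X` admits a holomorphic injective immersion into some projective space `ℙ^N(ℂ)`. For compact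
`X` this is a closed embedding. A map to `ℙ^N` is holomorphic if it locally lifts to a holomorphic
map `F` to `ℂ^(N+1) ∖ {0}`; since the tangent space of `ℙ^N` at `[F x]` is
`ℂ^(N+1) / ℂ (F x)`, up to a scalar, it is an immersion at `x` if `v = 0` is the only
tangent vector which the differential of `F` maps into `ℂ (F x)`. -/
def IsProjective : Prop :=
  ∃ (N : ℕ) (f : X → ℙ ℂ (Fin (N + 1) → ℂ)), Function.Injective f ∧
    ∀ x : X, ∃ U : Set X, IsOpen U ∧ x ∈ U ∧ ∃ F : X → (Fin (N + 1) → ℂ),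
      MDifferentiableOn 𝓘(ℂ, Model) 𝓘(ℂ, Fin (N + 1) → ℂ) F U ∧
      (∀ y ∈ U, ∃ hy : F y ≠ 0, f y = Projectivization.mk ℂ (F y) hy) ∧
      ∀ v : TangentSpace 𝓘(ℂ, Model) x,
        (∃ c : ℂ, (mfderiv 𝓘(ℂ, Model) 𝓘(ℂ, Fin (N + 1) → ℂ) F x v : Fin (N + 1) → ℂ)
          = c • F x) → v = 0

variable (X) in
/-- (Smooth) Calabi-Yau threefolds: connected compact complex manifolds of dimension `3` which are
projective, have trivial canonical bundle (that is, a nowhere vanishing holomorphic `3`-form) and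
have no nonzero holomorphic `p`-forms for `p = 1, 2`. -/
structure IsCalabiYauThreefold : Prop where
  isManifold : IsManifold 𝓘(ℂ, Model) ω X
  t2 : T2Space X
  compact : CompactSpace X
  connected : ConnectedSpace X
  projective : IsProjective X
  trivialCanonical : ∃ η : Form ℂ X 3, η.IsHolomorphic ∧ ∀ x, η x ≠ 0
  noForms : ∀ p : ℕ, 1 ≤ p → p ≤ 2 → ∀ α : Form ℂ X p, α.IsHolomorphic → α = 0

/-- Closed analytic subsets: near every point of `X` the set is the common zero locus of finitely
many holomorphic functions. -/
def IsAnalyticSubset (A : Set X) : Prop :=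
  ∀ x : X, ∃ U : Set X, IsOpen U ∧ x ∈ U ∧ ∃ (k : ℕ) (f : Fin k → X → ℂ),
    (∀ i, MDifferentiableOn 𝓘(ℂ, Model) 𝓘(ℂ, ℂ) (f i) U) ∧
    ∀ y ∈ U, y ∈ A ↔ ∀ i, f i y = 0

/-- An analytic subset is irreducible if it is not empty and not the union of two proper analytic
subsets. -/
def IsIrreducibleAnalytic (A : Set X) : Prop :=
  IsAnalyticSubset A ∧ A.Nonempty ∧
    ∀ B C : Set X, IsAnalyticSubset B → IsAnalyticSubset C → A = B ∪ C → A = B ∨ A = C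

/-- `A` is smooth of dimension `d` at the point `x` of `A`: in suitable holomorphic
coordinates around `x` it is a linear subspace of dimension `d`. -/
def IsSmoothOfDimAt (A : Set X) (d : ℕ) (x : X) : Prop :=
  x ∈ A ∧ ∃ e ∈ IsManifold.maximalAtlas 𝓘(ℂ, Model) ω X, x ∈ e.source ∧
    ∃ W : Submodule ℂ Model, Module.finrank ℂ W = d ∧
      ∀ y ∈ e.source, y ∈ A ↔ e y - e x ∈ W

/-- An analytic subset has dimension `d` if `d` is the largest dimension that it has at a smooth
point. -/
def HasDim (A : Set X) (d : ℕ) : Prop :=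
  (∃ x, IsSmoothOfDimAt A d x) ∧ ∀ x d', IsSmoothOfDimAt A d' x → d' ≤ d

/-- A curve in `X` is an irreducible closed analytic subset of dimension `1`. -/
def IsCurve (C : Set X) : Prop :=
  IsIrreducibleAnalytic C ∧ HasDim C 1

/-- `A` is smooth of pure dimension `d`: it is smooth of dimension `d` at each of its points. -/
def IsSmoothOfPureDim (A : Set X) (d : ℕ) : Prop :=
  ∀ x ∈ A, IsSmoothOfDimAt A d x

/-- A linear map `f` is a quasi-reflection if `f - id` has rank one. -/
def IsQuasiReflection {V : Type*} [AddCommGroup V] [Module ℂ V] (f : V →ₗ[ℂ] V) : Prop :=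
  (f - LinearMap.id).rank = 1

/-- The differential `d_P h : T_P X → T_P X` of `h` at a fixed point `P`; the tangent spaces at `P`
and at `h P = P` are literally `Model`, by means of the same preferred chart. -/
def diffAt (h : X → X) (P : X) : Model →ₗ[ℂ] Model :=
  (mfderiv 𝓘(ℂ, Model) 𝓘(ℂ, Model) h P : Model →L[ℂ] Model).toLinearMap

/-- The cyclic group generated by the map `g` of finite order (whose elements are the iterates of
`g`) is small: no differential of an element at a fixed point of it is a quasi-reflection. -/
def IsSmall (g : X → X) : Prop :=
  ∀ (n : ℕ) (P : X), g^[n] P = P → ¬ IsQuasiReflection (diffAt (g^[n]) P)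

/-- `g` is of order two. -/
def IsInvolution (g : X → X) : Prop :=
  Function.Involutive g ∧ g ≠ id

/-- `g` is symplectic: `g^*` is the identity on `H^{0,3}(X)`. -/
def IsSymplectic (g : X → X) : Prop :=
  ∀ α : Form ℝ X 3, α.RepresentsH0 → (α.pullback g).IsCohomologous α

end Geometry

end CYThreefold

end

open scoped Manifold ContDiff LinearAlgebra.Projectivization

noncomputable section

/-! Let `η` be a nowhere vanishing holomorphic 3-form. As `X` is compact and connected, `g^*η / η`
is a constant `c` (`exists_pullback_eq_smul`), and both sides of the equivalence are read off from
`c`.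

On the fixed locus: averaging over the group linearizes an involution at a fixed point `P`, so
`Fix(g)` is smooth at `P` of dimension `d`, the dimension of the 1-eigenspace of `d_P g`
(`isSmoothOfDimAt_fixedPoints`). Moreover `c = det (d_P g) = (-1)^(3-d)`. Smallness excludes `d =
2`, and `d = 3` would force `g = id` by connectedness. Hence `d = 1` if `c = 1` and `d = 0`
otherwise, at all fixed points simultaneously (`finrank_ker_eq`). Therefore `c = 1` means pure
dimension 1. A connected component of a smooth `Fix(g)` of pure dimension 1 is a curve, and
conversely a smooth point of a curve inside `Fix(g)` forces `d = 1` there.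

On cohomology: the conjugate of the coefficient of a closed `(0,3)`-form is holomorphic, so these
forms are the constant multiples of the conjugate of `η`
(`Form.RepresentsH0.exists_eq_smul_conjugate`), on which `g^*` acts by the conjugate of `c`. If `c =
1`, then `g` is symplectic. For the converse, a nonzero multiple of the conjugate of `η` must not be
exact (`eq_zero_of_hasExtDeriv`): if it were `dβ`, Stokes' theorem for `η ∧ β` would give `∫ |η|² =
0`. This is proved with a partition of unity and Lebesgue integrals in charts: `|η|²` changes by the
real Jacobian, and holomorphy of `η` kills the terms in which `η` is differentiated. -/

namespace CYThreefold

/-! ### Smoothness of holomorphic maps in several variables -/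

section SeveralComplexVariables

variable {E F : Type*} [NormedAddCommGroup E] [NormedSpace ℂ E] [NormedAddCommGroup F]
  [NormedSpace ℂ F]

/-- Cauchy's estimate for the Fréchet derivative of a holomorphic map. -/
theorem norm_fderiv_le_of_norm_le {f : E → F} {z : E} {ε M : ℝ} (hε : 0 < ε)
    (hf : ∀ y ∈ Metric.closedBall z ε, DifferentiableAt ℂ f y)
    (hM : ∀ y ∈ Metric.closedBall z ε, ‖f y‖ ≤ M) : ‖fderiv ℂ f z‖ ≤ M / ε := by
  have hM0 : 0 ≤ M := (norm_nonneg _).trans (hM z (Metric.mem_closedBall_self hε.le))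
  refine ContinuousLinearMap.opNorm_le_bound _ (by positivity) fun w => ?_
  rcases eq_or_ne w 0 with rfl | hw
  · simp
  have hw' : 0 < ‖w‖ := norm_pos_iff.2 hw
  have hmem : ∀ t : ℂ, t ∈ Metric.closedBall (0 : ℂ) (ε / ‖w‖) →
      z + t • w ∈ Metric.closedBall z ε := by
    intro t ht
    rw [mem_closedBall_zero_iff, le_div_iff₀ hw'] at ht
    simpa [norm_smul] using ht
  have hd : ∀ t ∈ Metric.closedBall (0 : ℂ) (ε / ‖w‖),
      DifferentiableAt ℂ (fun t : ℂ => f (z + t • w)) t := by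
    intro t ht
    exact DifferentiableAt.comp (g := f) t (hf _ (hmem t ht)) (by fun_prop)
  have hder : deriv (fun t : ℂ => f (z + t • w)) 0 = fderiv ℂ f z w := by
    have h0 : HasFDerivAt f (fderiv ℂ f z) (z + (0 : ℂ) • w) := by
      simpa using (hf z (Metric.mem_closedBall_self hε.le)).hasFDerivAt
    have h1 : HasDerivAt (fun t : ℂ => z + t • w) w 0 := by
      simpa using ((hasDerivAt_id (0 : ℂ)).smul_const w).const_add z
    exact (h0.comp_hasDerivAt (0 : ℂ) h1).deriv
  rw [← hder]
  refine (Complex.norm_deriv_le_of_forall_mem_sphere_norm_le (C := M) (R := ε / ‖w‖)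
    (by positivity) ?_ ?_).trans (le_of_eq (by field_simp))
  · refine DifferentiableOn.diffContOnCl fun t ht => ?_
    exact (hd t (Metric.closure_ball_subset_closedBall ht)).differentiableWithinAt
  · exact fun t ht => hM _ (hmem t (Metric.sphere_subset_closedBall ht))

variable [FiniteDimensional ℂ E] [FiniteDimensional ℂ F]

/-- Cauchy's formula on the complex line through `y` in direction `v` writes the derivative as an
integral of `f` over a circle whose radius and kernel do not depend on `y`. One then differentiates
under the integral sign, with Cauchy's estimate as dominating bound. -/
theorem differentiableOn_fderiv_apply {f : E → F} {s : Set E} (hs : IsOpen s)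
    (hf : DifferentiableOn ℂ f s) (v : E) : DifferentiableOn ℂ (fun y => fderiv ℂ f y v) s := by
  intro x₀ hx₀
  refine DifferentiableAt.differentiableWithinAt ?_
  have hfd : ∀ y ∈ s, DifferentiableAt ℂ f y := fun y hy => hf.differentiableAt (hs.mem_nhds hy)
  have : ProperSpace E := FiniteDimensional.proper ℂ E
  have : CompleteSpace F := FiniteDimensional.complete ℂ F
  have : FiniteDimensional ℝ E := FiniteDimensional.complexToReal E
  have : FiniteDimensional ℝ F := FiniteDimensional.complexToReal F
  obtain ⟨δ, hδ, hδs⟩ := Metric.nhds_basis_closedBall.mem_iff.1 (hs.mem_nhds hx₀)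
  obtain ⟨M, hM⟩ := (isCompact_closedBall x₀ δ).exists_bound_of_continuousOn
    (hf.continuousOn.mono hδs)
  -- Three displacements of size `ε` must fit into the ball of radius `δ`: from `x₀` to `y`, from
  -- `y` to the circle, and the ball for Cauchy's estimate.
  set ε := δ / 3 with hεd
  have hε : 0 < ε := by positivity
  set R := ε / (‖v‖ + 1) with hR
  have hR0 : 0 < R := by positivity
  have hRv : R * ‖v‖ ≤ ε := by
    rw [hR, div_mul_eq_mul_div, div_le_iff₀ (by positivity)]
    nlinarith [norm_nonneg v]
  have hmem : ∀ y ∈ Metric.ball x₀ ε, ∀ t ∈ Metric.closedBall (0 : ℂ) R,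
      y + t • v ∈ Metric.closedBall x₀ (2 * ε) := by
    intro y hy t ht
    rw [mem_closedBall_zero_iff] at ht
    rw [mem_ball_iff_norm] at hy
    rw [mem_closedBall_iff_norm]
    calc ‖y + t • v - x₀‖ = ‖(y - x₀) + t • v‖ := by congr 1; abel
      _ ≤ ‖y - x₀‖ + ‖t‖ * ‖v‖ := (norm_add_le _ _).trans (by rw [norm_smul])
      _ ≤ ε + R * ‖v‖ := by gcongr
      _ ≤ 2 * ε := by linarith
  have h2 : Metric.closedBall x₀ (2 * ε) ⊆ s :=
    (Metric.closedBall_subset_closedBall (by linarith)).trans hδs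
  have hbound : ∀ z ∈ Metric.closedBall x₀ (2 * ε), ‖fderiv ℂ f z‖ ≤ M / ε := by
    intro z hz
    have hsub : Metric.closedBall z ε ⊆ Metric.closedBall x₀ δ :=
      Metric.closedBall_subset_closedBall' (by
        rw [Metric.mem_closedBall] at hz; linarith)
    exact norm_fderiv_le_of_norm_le hε (fun y hy => hfd y (hδs (hsub hy))) fun y hy => hM y (hsub hy)
  have hcirc : ∀ θ, circleMap 0 R θ ∈ Metric.closedBall (0 : ℂ) R :=
    fun θ => circleMap_mem_closedBall _ hR0.le _
  set k : ℝ → ℂ := fun θ => deriv (circleMap 0 R) θ * ((circleMap 0 R θ - 0) ^ 2)⁻¹ with hk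
  have hkc : Continuous k := by
    rw [hk]
    simp only [deriv_circleMap]
    refine Continuous.mul (by fun_prop) (Continuous.inv₀ (by fun_prop) fun θ => ?_)
    have : circleMap 0 R θ ≠ 0 := circleMap_ne_center hR0.ne'
    simpa using this
  have hform : ∀ y ∈ Metric.ball x₀ ε, fderiv ℂ f y v =
      (2 * Real.pi * Complex.I : ℂ)⁻¹ •
        ∫ θ in (0 : ℝ)..2 * Real.pi, k θ • f (y + circleMap 0 R θ • v) := by
    intro y hy
    have hys : y ∈ s := h2 (by simpa using hmem y hy 0 (Metric.mem_closedBall_self hR0.le))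
    have hd : ∀ t ∈ Metric.closedBall (0 : ℂ) R,
        DifferentiableAt ℂ (fun t : ℂ => f (y + t • v)) t := fun t ht =>
      DifferentiableAt.comp (g := f) t (hfd _ (h2 (hmem y hy t ht))) (by fun_prop)
    have hder : deriv (fun t : ℂ => f (y + t • v)) 0 = fderiv ℂ f y v := by
      have h0 : HasFDerivAt f (fderiv ℂ f y) (y + (0 : ℂ) • v) := by
        simpa using (hfd y hys).hasFDerivAt
      have h1 : HasDerivAt (fun t : ℂ => y + t • v) v 0 := by
        simpa using ((hasDerivAt_id (0 : ℂ)).smul_const v).const_add y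
      exact (h0.comp_hasDerivAt (0 : ℂ) h1).deriv
    have hdc : DiffContOnCl ℂ (fun t : ℂ => f (y + t • v)) (Metric.ball 0 R) :=
      DifferentiableOn.diffContOnCl fun t ht =>
        (hd t (Metric.closure_ball_subset_closedBall ht)).differentiableWithinAt
    rw [← hder, eq_inv_smul_iff₀ Complex.two_pi_I_ne_zero,
      ← hdc.deriv_eq_smul_circleIntegral hR0, circleIntegral]
    refine intervalIntegral.integral_congr fun θ _ => ?_
    simp only [hk, mul_smul, one_div]
  have hmain : DifferentiableAt ℂ
      (fun y => ∫ θ in (0 : ℝ)..2 * Real.pi, k θ • f (y + circleMap 0 R θ • v)) x₀ := by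
    have hcont : ∀ y ∈ Metric.ball x₀ ε,
        Continuous fun θ => k θ • f (y + circleMap 0 R θ • v) := by
      intro y hy
      refine hkc.smul (continuous_iff_continuousAt.2 fun θ => ?_)
      exact ContinuousAt.comp (g := f) (hfd _ (h2 (hmem y hy _ (hcirc θ)))).continuousAt
        (by fun_prop)
    borelize E
    borelize (E →L[ℂ] F)
    have : FiniteDimensional ℂ (E →L[ℂ] F) := inferInstance
    have : ProperSpace (E →L[ℂ] F) := FiniteDimensional.proper ℂ _
    refine (intervalIntegral.hasFDerivAt_integral_of_dominated_of_fderiv_le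
      (F' := fun y θ => k θ • fderiv ℂ f (y + circleMap 0 R θ • v))
      (bound := fun θ => ‖k θ‖ * (M / ε)) (Metric.ball_mem_nhds x₀ hε) ?_ ?_ ?_ ?_ ?_
      ?_).differentiableAt
    · filter_upwards [Metric.ball_mem_nhds x₀ hε] with y hy
      exact (hcont y hy).aestronglyMeasurable
    · exact (hcont x₀ (Metric.mem_ball_self hε)).intervalIntegrable _ _
    -- The derivative of `f` is not yet known to be continuous, but it is measurable in any case.
    · refine (hkc.measurable.smul ((measurable_fderiv ℂ f).comp ?_)).aestronglyMeasurable
      exact Continuous.measurable (by fun_prop)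
    · refine Filter.Eventually.of_forall fun θ _ y hy => ?_
      rw [norm_smul]
      gcongr
      exact hbound _ (hmem y hy _ (hcirc θ))
    · exact (hkc.norm.mul continuous_const).intervalIntegrable _ _
    · refine Filter.Eventually.of_forall fun θ _ y hy => ?_
      have := (hfd _ (h2 (hmem y hy _ (hcirc θ)))).hasFDerivAt
      exact ((hasFDerivAt_comp_add_right _).2 this).const_smul (k θ)
  refine (hmain.const_smul ((2 * Real.pi * Complex.I : ℂ)⁻¹)).congr_of_eventuallyEq ?_
  filter_upwards [Metric.ball_mem_nhds x₀ hε] with y hy using hform y hy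

/-- Holomorphic maps in several variables are smooth. -/
theorem contDiffOn_of_differentiableOn {f : E → F} {s : Set E} (hs : IsOpen s)
    (hf : DifferentiableOn ℂ f s) : ContDiffOn ℂ ∞ f s := by
  refine contDiffOn_infty.2 fun n => ?_
  induction n generalizing f with
  | zero => exact contDiffOn_zero.2 hf.continuousOn
  | succ n ih =>
    push_cast
    refine contDiffOn_succ_of_fderiv_apply hf (by simp) fun v => ?_
    refine (ih (differentiableOn_fderiv_apply hs hf v)).congr fun y hy => ?_
    rw [fderivWithin_of_isOpen hs hy]

end SeveralComplexVariables

/-! ### The component of type (0, n) of a real-multilinear form -/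

section AntiPart

open Complex ComplexConjugate

variable {E E' : Type*} [NormedAddCommGroup E] [NormedSpace ℂ E]
  [NormedAddCommGroup E'] [NormedSpace ℂ E'] {n : ℕ}

/-- Up to the factor `2 ^ n`, the component of type `(0, n)` of a real-multilinear form. -/
def antiSum (τ : E [⋀^Fin n]→L[ℝ] ℂ) (v : Fin n → E) : ℂ :=
  ∑ s : Fin n → Fin 2, (∏ i, I ^ (s i : ℕ)) * τ fun i => I ^ (s i : ℕ) • v i

theorem antiSum_add (τ τ' : E [⋀^Fin n]→L[ℝ] ℂ) (v : Fin n → E) :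
    antiSum (τ + τ') v = antiSum τ v + antiSum τ' v := by
  simp [antiSum, mul_add, Finset.sum_add_distrib]

theorem antiSum_smul (c : ℂ) (τ : E [⋀^Fin n]→L[ℝ] ℂ) (v : Fin n → E) :
    antiSum (c • τ) v = c * antiSum τ v := by
  simp only [antiSum, Finset.mul_sum, ContinuousAlternatingMap.smul_apply, smul_eq_mul]
  exact Finset.sum_congr rfl fun _ _ => by ring

theorem antiSum_compContinuousLinearMap (τ : E' [⋀^Fin n]→L[ℝ] ℂ) (A : E →L[ℂ] E')
    (v : Fin n → E) :
    antiSum (τ.compContinuousLinearMap (A.restrictScalars ℝ)) v = antiSum τ (A ∘ v) := by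
  simp [antiSum, Function.comp_def]

theorem sum_fin_succAbove (i : Fin (n + 1)) (g : (Fin (n + 1) → Fin 2) → ℂ) :
    ∑ s, g s = ∑ s : Fin n → Fin 2, ∑ a : Fin 2, g (i.insertNth a s) := by
  rw [← (Fin.insertNthEquiv (fun _ => Fin 2) i).sum_comp, Fintype.sum_prod_type,
    Finset.sum_comm]
  rfl

theorem pow_smul_insertNth (i : Fin (n + 1)) (a : Fin 2) (s : Fin n → Fin 2) (x : E)
    (v : Fin n → E) :
    (fun j => I ^ ((i.insertNth a s : Fin (n + 1) → Fin 2) j : ℕ) •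
      (i.insertNth x v : Fin (n + 1) → E) j) =
      i.insertNth (I ^ (a : ℕ) • x) fun j => I ^ (s j : ℕ) • v j := by
  funext j
  refine Fin.succAboveCases i ?_ (fun k => ?_) j <;> simp

theorem prod_insertNth (i : Fin (n + 1)) (a : Fin 2) (s : Fin n → Fin 2) :
    ∏ j, I ^ ((i.insertNth a s : Fin (n + 1) → Fin 2) j : ℕ) =
      I ^ (a : ℕ) * ∏ j, I ^ (s j : ℕ) := by
  rw [Fin.prod_univ_succAbove _ i]
  simp

theorem antiSum_insertNth (τ : E [⋀^Fin (n + 1)]→L[ℝ] ℂ) (i : Fin (n + 1)) (x : E)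
    (v : Fin n → E) : antiSum τ (i.insertNth x v) =
      ∑ s : Fin n → Fin 2, (∏ j, I ^ (s j : ℕ)) *
        (τ (i.insertNth x fun j => I ^ (s j : ℕ) • v j) +
          I * τ (i.insertNth (I • x) fun j => I ^ (s j : ℕ) • v j)) := by
  rw [antiSum, sum_fin_succAbove i]
  refine Finset.sum_congr rfl fun s _ => ?_
  simp only [pow_smul_insertNth, prod_insertNth, Fin.sum_univ_two]
  simp
  ring

/-- In each pair `τ(x) + I τ(I x)` the substitution of `I x` for `x` gives `τ(I x) - I τ(x)`, which
is `-I` times the pair. -/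
theorem antiSum_insertNth_I_smul (τ : E [⋀^Fin (n + 1)]→L[ℝ] ℂ) (i : Fin (n + 1)) (x : E)
    (v : Fin n → E) : antiSum τ (i.insertNth (I • x) v) = -I * antiSum τ (i.insertNth x v) := by
  rw [antiSum_insertNth, antiSum_insertNth, Finset.mul_sum]
  refine Finset.sum_congr rfl fun s _ => ?_
  have : τ (i.insertNth (I • I • x) fun j => I ^ (s j : ℕ) • v j) =
      -τ (i.insertNth x fun j => I ^ (s j : ℕ) • v j) := by
    have h := τ.map_update_smul (i.insertNth x fun j => I ^ (s j : ℕ) • v j) i (-1 : ℝ) x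
    rw [Fin.update_insertNth, Fin.update_insertNth] at h
    rw [smul_smul, I_mul_I]
    simpa using h
  rw [this]
  linear_combination (∏ j, I ^ (s j : ℕ)) * τ (i.insertNth (I • x) fun j => I ^ (s j : ℕ) • v j) *
    I_sq

theorem antiSum_insertNth_add (τ : E [⋀^Fin (n + 1)]→L[ℝ] ℂ) (i : Fin (n + 1)) (x y : E)
    (v : Fin n → E) : antiSum τ (i.insertNth (x + y) v) =
      antiSum τ (i.insertNth x v) + antiSum τ (i.insertNth y v) := by
  have h : ∀ (w : Fin n → E) (x y : E), τ (i.insertNth (x + y) w) =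
      τ (i.insertNth x w) + τ (i.insertNth y w) := by
    intro w x y
    have h := τ.map_update_add (i.insertNth x w) i x y
    rwa [Fin.update_insertNth, Fin.update_insertNth, Fin.update_insertNth] at h
  simp only [antiSum_insertNth, smul_add, h, ← Finset.sum_add_distrib]
  exact Finset.sum_congr rfl fun _ _ => by ring

theorem antiSum_insertNth_real_smul (τ : E [⋀^Fin (n + 1)]→L[ℝ] ℂ) (i : Fin (n + 1)) (r : ℝ)
    (x : E) (v : Fin n → E) : antiSum τ (i.insertNth ((r : ℂ) • x) v) =
      r * antiSum τ (i.insertNth x v) := by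
  have h : ∀ (w : Fin n → E) (x : E), τ (i.insertNth ((r : ℂ) • x) w) =
      r * τ (i.insertNth x w) := by
    intro w x
    have h := τ.map_update_smul (i.insertNth x w) i r x
    rw [Fin.update_insertNth, Fin.update_insertNth] at h
    simpa using h
  simp only [antiSum_insertNth, smul_comm I (r : ℂ), h, Finset.mul_sum]
  exact Finset.sum_congr rfl fun _ _ => by ring

theorem antiSum_insertNth_smul (τ : E [⋀^Fin (n + 1)]→L[ℝ] ℂ) (i : Fin (n + 1)) (c : ℂ)
    (x : E) (v : Fin n → E) : antiSum τ (i.insertNth (c • x) v) =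
      conj c * antiSum τ (i.insertNth x v) := by
  conv_lhs => rw [← re_add_im c, add_smul, antiSum_insertNth_add, antiSum_insertNth_real_smul,
    mul_smul, antiSum_insertNth_real_smul, antiSum_insertNth_I_smul]
  have hc : conj c = c.re - c.im * I := by apply Complex.ext <;> simp
  rw [hc]
  ring

/-- Transposing `i` and `j` in the summation index preserves the product of powers of `I` and
transposes two arguments of `τ`, so the sum equals its own negative. -/
theorem antiSum_eq_zero_of_eq (τ : E [⋀^Fin n]→L[ℝ] ℂ) {v : Fin n → E} {i j : Fin n}
    (h : v i = v j) (hij : i ≠ j) : antiSum τ v = 0 := by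
  have key : antiSum τ v = -antiSum τ v := by
    conv_lhs => rw [antiSum, ← ((Equiv.swap i j).arrowCongr (Equiv.refl (Fin 2))).sum_comp]
    rw [antiSum, ← Finset.sum_neg_distrib]
    refine Finset.sum_congr rfl fun s _ => ?_
    have h1 : (∏ k, I ^ (((Equiv.swap i j).arrowCongr (Equiv.refl (Fin 2))) s k : ℕ)) =
        ∏ k, I ^ (s k : ℕ) :=
      (Equiv.swap i j).symm.prod_comp fun k => I ^ (s k : ℕ)
    have h2 : (fun k => I ^ (((Equiv.swap i j).arrowCongr (Equiv.refl (Fin 2))) s k : ℕ) • v k) =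
        (fun k => I ^ (s k : ℕ) • v k) ∘ Equiv.swap i j := by
      funext k
      have : v (Equiv.swap i j k) = v k := by
        rcases eq_or_ne k i with rfl | hk
        · simp [h]
        rcases eq_or_ne k j with rfl | hk'
        · simp [h]
        rw [Equiv.swap_apply_of_ne_of_ne hk hk']
      simp [this]
    rw [h1, h2]
    have := τ.toAlternatingMap.map_swap (fun k => I ^ (s k : ℕ) • v k) hij
    simp only [ContinuousAlternatingMap.coe_toAlternatingMap] at this
    rw [this, mul_neg]
  have : (2 : ℂ) * antiSum τ v = 0 := by linear_combination key
  simpa using this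

/-- The conjugate of `antiSum τ`, as a complex alternating form. -/
def antiForm (τ : E [⋀^Fin (n + 1)]→L[ℝ] ℂ) : E [⋀^Fin (n + 1)]→ₗ[ℂ] ℂ where
  toFun v := conj (antiSum τ v)
  map_update_add' := by
    intro dec v i x y
    obtain rfl : dec = instDecidableEqFin _ := Subsingleton.elim _ _
    simp only [← Fin.insertNth_removeNth, antiSum_insertNth_add, map_add]
  map_update_smul' := by
    intro dec v i c x
    obtain rfl : dec = instDecidableEqFin _ := Subsingleton.elim _ _
    simp only [← Fin.insertNth_removeNth, antiSum_insertNth_smul, map_mul, conj_conj, smul_eq_mul]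
  map_eq_zero_of_eq' v i j h hij := by
    rw [antiSum_eq_zero_of_eq τ h hij, map_zero]

/-- `antiForm τ` is a complex alternating form of top degree, hence is multiplied by the
determinant; conjugating back produces the conjugate determinant. -/
theorem antiSum_comp_linearMap (τ : E [⋀^Fin (n + 1)]→L[ℝ] ℂ)
    (b : Module.Basis (Fin (n + 1)) ℂ E) (A : E →ₗ[ℂ] E) :
    antiSum τ (A ∘ b) = conj (LinearMap.det A) * antiSum τ b := by
  have h := congrArg (fun f : E [⋀^Fin (n + 1)]→ₗ[ℂ] ℂ => f (A ∘ b))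
    (AlternatingMap.eq_smul_basis_det b (antiForm τ))
  simp only [AlternatingMap.smul_apply, Module.Basis.det_comp_basis, smul_eq_mul] at h
  change conj (antiSum τ (A ∘ b)) = conj (antiSum τ b) * _ at h
  have := congrArg conj h
  simpa [mul_comm] using this

/-- A wedge product with a factor of type (1, 0) has no component of type (0, n + 1): in the slot
taken by `f` the two powers of `I` contribute `1 + I * I = 0`. Applied to `f = dh ⊗ b`, this removes
the derivative of a holomorphic `h`. -/
theorem antiSum_alternatizeUncurryFin_eq_zero (f : E →L[ℝ] E [⋀^Fin n]→L[ℝ] ℂ)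
    (hf : ∀ v, f (I • v) = I • f v) (v : Fin (n + 1) → E) :
    antiSum (ContinuousAlternatingMap.alternatizeUncurryFin f) v = 0 := by
  simp only [antiSum, ContinuousAlternatingMap.alternatizeUncurryFin_apply, Finset.mul_sum]
  rw [Finset.sum_comm]
  refine Finset.sum_eq_zero fun i _ => ?_
  rw [sum_fin_succAbove i]
  refine Finset.sum_eq_zero fun s _ => ?_
  have h : ∀ a : Fin 2, (i.removeNth fun j =>
      I ^ ((i.insertNth a s : Fin (n + 1) → Fin 2) j : ℕ) • v j) =
      fun j => I ^ (s j : ℕ) • v (i.succAbove j) := by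
    intro a
    funext j
    simp [Fin.removeNth]
  simp only [h, prod_insertNth, Fin.sum_univ_two]
  simp [hf]
  linear_combination (∏ j, I ^ (s j : ℕ)) * ((-1) ^ (i : ℕ) *
    f (v i) fun j => I ^ (s j : ℕ) • v (i.succAbove j)) * I_sq

/-- On a form already of type (0, n) each of the `2 ^ n` terms equals `τ v`. This normalization is
the source of the factor 8 in degree 3. -/
theorem antiSum_of_antilinear (τ : E [⋀^Fin n]→L[ℝ] ℂ) (v : Fin n → E)
    (hτ : ∀ c : Fin n → ℂ, τ (fun i => c i • v i) = (∏ i, conj (c i)) * τ v) :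
    antiSum τ v = 2 ^ n * τ v := by
  have : ∀ s : Fin n → Fin 2,
      (∏ i, I ^ (s i : ℕ)) * τ (fun i => I ^ (s i : ℕ) • v i) = τ v := by
    intro s
    rw [hτ, ← mul_assoc, ← Finset.prod_mul_distrib, Finset.prod_eq_one, one_mul]
    intro i _
    rw [map_pow, conj_I, ← mul_pow, mul_neg, I_mul_I, neg_neg, one_pow]
  rw [antiSum, Finset.sum_congr rfl fun s _ => this s]
  simp

end AntiPart

/-! ### Determinants of linear involutions -/

section Involutions

/-- The determinant of a linear involution. -/
theorem det_of_involutive {V : Type*} [AddCommGroup V] [Module ℂ V] [FiniteDimensional ℂ V]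
    (A : V →ₗ[ℂ] V) (hA : A ∘ₗ A = LinearMap.id) :
    LinearMap.det A =
      (-1) ^ (Module.finrank ℂ V - Module.finrank ℂ (LinearMap.ker (A - LinearMap.id))) := by
  set W := LinearMap.ker (A - LinearMap.id) with hW
  have hmem : ∀ v, v ∈ W ↔ A v = v := fun v => by simp [hW, sub_eq_zero]
  have hAA : ∀ v, A (A v) = v := fun v => LinearMap.congr_fun hA v
  have he : W ≤ W.comap A := fun v hv => by
    rw [Submodule.mem_comap, (hmem v).1 hv]; exact hv
  rw [LinearMap.det_eq_det_mul_det W A he]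
  have h1 : A.restrict he = LinearMap.id := by
    ext v
    simpa using (hmem v).1 v.2
  -- On the quotient by the fixed space `A` is `-1`, because `A v + v` is fixed.
  have h2 : W.mapQ W A he = (-1 : ℂ) • LinearMap.id := by
    ext v
    simp only [LinearMap.coe_comp, Function.comp_apply, Submodule.mkQ_apply, Submodule.mapQ_apply,
      LinearMap.smul_apply, LinearMap.id_apply]
    rw [← Submodule.Quotient.mk_smul, Submodule.Quotient.eq, hmem]
    simp [hAA, add_comm]
  rw [h1, h2, LinearMap.det_smul]
  simp [Submodule.finrank_quotient]

end Involutions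

/-! ### Complex manifolds as real manifolds -/

section RestrictScalars

variable {E F M N : Type*} [NormedAddCommGroup E] [NormedSpace ℂ E] [NormedAddCommGroup F]
  [NormedSpace ℂ F] [TopologicalSpace M] [ChartedSpace E M] [TopologicalSpace N] [ChartedSpace F N]

theorem hasMFDerivAt_restrictScalars {f : M → N} {x : M} {f' : E →L[ℂ] F}
    (hf : HasMFDerivAt 𝓘(ℂ, E) 𝓘(ℂ, F) f x f') :
    HasMFDerivAt 𝓘(ℝ, E) 𝓘(ℝ, F) f x (f'.restrictScalars ℝ : E →L[ℝ] F) := by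
  refine ⟨hf.1, ?_⟩
  have h : HasFDerivWithinAt (writtenInExtChartAt 𝓘(ℂ, E) 𝓘(ℂ, F) x f) f'
    (Set.range 𝓘(ℂ, E)) (extChartAt 𝓘(ℂ, E) x x) := hf.2
  exact h.restrictScalars ℝ

theorem mfderiv_restrictScalars {f : M → N} {x : M}
    (hf : MDifferentiableAt 𝓘(ℂ, E) 𝓘(ℂ, F) f x) :
    (mfderiv 𝓘(ℝ, E) 𝓘(ℝ, F) f x : E →L[ℝ] F) =
      (mfderiv 𝓘(ℂ, E) 𝓘(ℂ, F) f x : E →L[ℂ] F).restrictScalars ℝ :=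
  (hasMFDerivAt_restrictScalars hf.hasMFDerivAt).mfderiv

theorem isManifold_restrictScalars (n : WithTop ℕ∞) [IsManifold 𝓘(ℂ, E) n M] :
    IsManifold 𝓘(ℝ, E) n M := by
  refine isManifold_of_contDiffOn _ _ _ fun e e' he he' => ?_
  have h := (contDiffGroupoid n 𝓘(ℂ, E)).compatible he he'
  rw [contDiffGroupoid, mem_groupoid_of_pregroupoid] at h
  have h' : ContDiffOn ℂ n (𝓘(ℂ, E) ∘ (e.symm.trans e') ∘ 𝓘(ℂ, E).symm)
    (𝓘(ℂ, E).symm ⁻¹' (e.symm.trans e').source ∩ Set.range 𝓘(ℂ, E)) := h.1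
  simpa using h'.restrict_scalars ℝ

end RestrictScalars

/-! ### Forms and self-maps in charts, and the maximum principle -/

section Charts

variable {X : Type*} [TopologicalSpace X]

theorem eventually_coordinates {g : X → X} {e e' : OpenPartialHomeomorph X Model} {y : Model}
    (hg : ContinuousAt g (e.symm y)) (hy : y ∈ e.target) (hy' : g (e.symm y) ∈ e'.source) :
    ∀ᶠ z in nhds y, z ∈ e.target ∧ g (e.symm z) ∈ e'.source :=
  (e.open_target.eventually_mem hy).and
    ((hg.comp (e.continuousAt_symm hy)).eventually_mem (e'.open_source.mem_nhds hy'))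

variable [ChartedSpace Model X]

/-- The standard frame of `ℂ³`. -/
abbrev stdFrame : Fin 3 → Model := Pi.basisFun ℂ (Fin 3)

/-- The differential of the inverse of the chart `e`. -/
def symmDeriv (e : OpenPartialHomeomorph X Model) (y : Model) : Model →L[ℂ] Model :=
  mfderiv 𝓘(ℂ, Model) 𝓘(ℂ, Model) e.symm y

theorem Form.inCoordinates_complex {p : ℕ} (α : Form ℂ X p) (e : OpenPartialHomeomorph X Model)
    (y : Model) (v : Fin p → Model) :
    α.inCoordinates e y v = α (e.symm y) (symmDeriv e y ∘ v) := rfl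

theorem alternating_apply_comp (η : Model [⋀^Fin 3]→L[ℂ] ℂ) (A : Model →L[ℂ] Model) :
    η (A ∘ stdFrame) = LinearMap.det (A : Model →ₗ[ℂ] Model) * η stdFrame := by
  have h := congrArg (fun f : Model [⋀^Fin 3]→ₗ[ℂ] ℂ => f (A ∘ stdFrame))
    (AlternatingMap.eq_smul_basis_det (Pi.basisFun ℂ (Fin 3)) η.toAlternatingMap)
  have h2 := Module.Basis.det_comp_basis (Pi.basisFun ℂ (Fin 3)) (Pi.basisFun ℂ (Fin 3))
    (A : Model →ₗ[ℂ] Model)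
  simp only [AlternatingMap.smul_apply, smul_eq_mul] at h
  simp only [ContinuousLinearMap.coe_coe] at h2
  rw [h2] at h
  exact h.trans (mul_comm _ _)

theorem alternating_eq_zero_iff (η : Model [⋀^Fin 3]→L[ℂ] ℂ) : η stdFrame = 0 ↔ η = 0 := by
  refine ⟨fun h => ?_, fun h => by simp [h]⟩
  have := AlternatingMap.map_basis_eq_zero_iff (Pi.basisFun ℂ (Fin 3)) η.toAlternatingMap
  exact ContinuousAlternatingMap.toAlternatingMap_injective (this.1 h)

theorem alternating_eq_smul (η η' : Model [⋀^Fin 3]→L[ℂ] ℂ) (h : η' stdFrame ≠ 0) :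
    η = (η stdFrame / η' stdFrame) • η' := by
  rw [← sub_eq_zero, ← alternating_eq_zero_iff]
  simp [div_mul_cancel₀ _ h]

theorem Form.inCoordinates_stdFrame (η : Form ℂ X 3) (e : OpenPartialHomeomorph X Model)
    (y : Model) : η.inCoordinates e y stdFrame =
      LinearMap.det (symmDeriv e y : Model →ₗ[ℂ] Model) *
        (η (e.symm y) : Model [⋀^Fin 3]→L[ℂ] ℂ) stdFrame :=
  alternating_apply_comp _ _

variable [IsManifold 𝓘(ℂ, Model) ω X] {e e' : OpenPartialHomeomorph X Model}

theorem hasMFDerivAt_symm (he : e ∈ atlas Model X) {y : Model} (hy : y ∈ e.target) :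
    HasMFDerivAt 𝓘(ℂ, Model) 𝓘(ℂ, Model) e.symm y (symmDeriv e y) :=
  (mdifferentiableAt_atlas_symm (I := 𝓘(ℂ, Model)) he hy).hasMFDerivAt

theorem Form.inCoordinates_real {p : ℕ} (α : Form ℝ X p) (he : e ∈ atlas Model X) {y : Model}
    (hy : y ∈ e.target) : α.inCoordinates e y =
      (α (e.symm y) : Model [⋀^Fin p]→L[ℝ] ℂ).compContinuousLinearMap
        ((symmDeriv e y).restrictScalars ℝ) := by
  have h := (hasMFDerivAt_restrictScalars (hasMFDerivAt_symm he hy)).mfderiv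
  exact congrArg (fun A : Model →L[ℝ] Model =>
    (α (e.symm y) : Model [⋀^Fin p]→L[ℝ] ℂ).compContinuousLinearMap A) h

theorem det_symmDeriv_ne_zero (he : e ∈ atlas Model X) {y : Model} (hy : y ∈ e.target) :
    LinearMap.det (symmDeriv e y : Model →ₗ[ℂ] Model) ≠ 0 := by
  have h := (mdifferentiable_of_mem_atlas (I := 𝓘(ℂ, Model)) he).comp_symm_deriv hy
  obtain ⟨A, hA⟩ : ∃ A : Model →L[ℂ] Model,
      A.comp (symmDeriv e y) = ContinuousLinearMap.id ℂ Model := ⟨_, h⟩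
  have h2 : LinearMap.det (A : Model →ₗ[ℂ] Model) *
      LinearMap.det (symmDeriv e y : Model →ₗ[ℂ] Model) = 1 := by
    rw [← LinearMap.det_comp, ← ContinuousLinearMap.toLinearMap_comp, hA]
    exact LinearMap.det_id
  exact right_ne_zero_of_mul_eq_one h2

theorem mdifferentiableAt_coordinates {g : X → X} {y : Model}
    (he : e ∈ atlas Model X) (he' : e' ∈ atlas Model X)
    (hg : MDifferentiableAt 𝓘(ℂ, Model) 𝓘(ℂ, Model) g (e.symm y))
    (hy : y ∈ e.target) (hy' : g (e.symm y) ∈ e'.source) :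
    DifferentiableAt ℂ (e' ∘ g ∘ e.symm) y := by
  rw [← mdifferentiableAt_iff_differentiableAt]
  exact (mdifferentiableAt_atlas (I := 𝓘(ℂ, Model)) he' hy').comp y
    (hg.comp y (mdifferentiableAt_atlas_symm (I := 𝓘(ℂ, Model)) he hy))

/-- The chain rule for the expression of `g` in coordinates. -/
theorem mfderiv_comp_symmDeriv {g : X → X} {y : Model}
    (he : e ∈ atlas Model X) (he' : e' ∈ atlas Model X)
    (hg : MDifferentiableAt 𝓘(ℂ, Model) 𝓘(ℂ, Model) g (e.symm y))
    (hy : y ∈ e.target) (hy' : g (e.symm y) ∈ e'.source) :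
    (mfderiv 𝓘(ℂ, Model) 𝓘(ℂ, Model) g (e.symm y) : Model →L[ℂ] Model).comp (symmDeriv e y) =
      (symmDeriv e' (e' (g (e.symm y)))).comp (fderiv ℂ (e' ∘ g ∘ e.symm) y) := by
  have h1 : HasMFDerivAt 𝓘(ℂ, Model) 𝓘(ℂ, Model) (g ∘ e.symm) y
      ((mfderiv 𝓘(ℂ, Model) 𝓘(ℂ, Model) g (e.symm y) : Model →L[ℂ] Model).comp
        (symmDeriv e y)) :=
    hg.hasMFDerivAt.comp y (hasMFDerivAt_symm he hy)
  have h2 : HasMFDerivAt 𝓘(ℂ, Model) 𝓘(ℂ, Model) (e'.symm ∘ (e' ∘ g ∘ e.symm)) y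
      ((symmDeriv e' (e' (g (e.symm y)))).comp (fderiv ℂ (e' ∘ g ∘ e.symm) y)) :=
    (hasMFDerivAt_symm he' (e'.map_source hy')).comp y
      (mdifferentiableAt_coordinates he he' hg hy hy').hasFDerivAt.hasMFDerivAt
  have h3 : g ∘ e.symm =ᶠ[nhds y] e'.symm ∘ (e' ∘ g ∘ e.symm) := ?_
  · have h4 := hasMFDerivAt_unique h1 (h2.congr_of_eventuallyEq h3)
    exact h4
  filter_upwards [eventually_coordinates hg.continuousAt hy hy'] with z hz
  simp [e'.left_inv hz.2]

theorem symmDeriv_eq_comp {y : Model} (he : e ∈ atlas Model X) (he' : e' ∈ atlas Model X)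
    (hy : y ∈ e.target) (hy' : e.symm y ∈ e'.source) :
    symmDeriv e y = (symmDeriv e' (e' (e.symm y))).comp (fderiv ℂ (e' ∘ e.symm) y) := by
  have h := mfderiv_comp_symmDeriv (g := id) he he' mdifferentiableAt_id hy hy'
  rw [mfderiv_id] at h
  exact h

/-- A function on a compact connected manifold that is holomorphic in every chart is constant. -/
theorem exists_eq_const_of_differentiableOn [CompactSpace X] [ConnectedSpace X] {f : X → ℂ}
    (hf : ∀ e ∈ atlas Model X, DifferentiableOn ℂ (f ∘ e.symm) e.target) : ∃ c, ∀ x, f x = c := by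
  have hmd : MDifferentiable 𝓘(ℂ, Model) 𝓘(ℂ, ℂ) f := by
    intro x
    have hx := mem_chart_source Model x
    have h1 : MDifferentiableAt 𝓘(ℂ, Model) 𝓘(ℂ, ℂ) (f ∘ (chartAt Model x).symm)
        (chartAt Model x x) := by
      rw [mdifferentiableAt_iff_differentiableAt]
      exact (hf _ (chart_mem_atlas _ x)).differentiableAt
        ((chartAt Model x).open_target.mem_nhds (mem_chart_target Model x))
    refine (h1.comp x (mdifferentiableAt_atlas (I := 𝓘(ℂ, Model))
      (chart_mem_atlas _ x) hx)).congr_of_eventuallyEq ?_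
    filter_upwards [(chartAt Model x).open_source.mem_nhds hx] with z hz
    simp [(chartAt Model x).left_inv hz]
  obtain ⟨c, hc⟩ := hmd.exists_eq_const_of_compactSpace
  exact ⟨c, fun x => congrFun hc x⟩

end Charts

/-! ### Forms of type (3, 0) and (0, 3) on ℂ³ -/

section VolumeForms

open Complex ComplexConjugate

/-- The form `dz₁ ∧ dz₂ ∧ dz₃` on `ℂ³`. -/
def detForm : Model [⋀^Fin 3]→L[ℂ] ℂ :=
  { (Matrix.detRowAlternating : Model [⋀^Fin 3]→ₗ[ℂ] ℂ) with
    cont := by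
      change Continuous fun v : Fin 3 → Model => Matrix.det v
      exact Continuous.matrix_det continuous_id }

theorem detForm_apply (v : Fin 3 → Model) : detForm v = Matrix.det v := rfl

theorem detForm_stdFrame : detForm stdFrame = 1 := by
  rw [detForm_apply, ← Matrix.det_one (n := Fin 3) (R := ℂ)]
  congr 1
  ext i j
  simp [stdFrame, Matrix.one_apply, Pi.single_apply, eq_comm]

theorem alternating_eq_smul_detForm (η : Model [⋀^Fin 3]→L[ℂ] ℂ) :
    η = η stdFrame • detForm := by
  have := alternating_eq_smul η detForm (by simp [detForm_stdFrame])
  rwa [detForm_stdFrame, div_one] at this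

/-- The complex conjugate of a complex alternating form. -/
def conjForm {E : Type*} [NormedAddCommGroup E] [NormedSpace ℂ E] {n : ℕ}
    (η : E [⋀^Fin n]→L[ℂ] ℂ) : E [⋀^Fin n]→L[ℝ] ℂ :=
  (conjCLE : ℂ →L[ℝ] ℂ).compContinuousAlternatingMap (η.restrictScalars ℝ)

@[simp]
theorem conjForm_apply {E : Type*} [NormedAddCommGroup E] [NormedSpace ℂ E] {n : ℕ}
    (η : E [⋀^Fin n]→L[ℂ] ℂ) (v : Fin n → E) : conjForm η v = conj (η v) := rfl

theorem conjForm_smul {E : Type*} [NormedAddCommGroup E] [NormedSpace ℂ E] {n : ℕ} (c : ℂ)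
    (η : E [⋀^Fin n]→L[ℂ] ℂ) : conjForm (c • η) = conj c • conjForm η := by
  ext v
  simp

theorem antiSum_conjForm {E : Type*} [NormedAddCommGroup E] [NormedSpace ℂ E] {n : ℕ}
    (η : E [⋀^Fin n]→L[ℂ] ℂ) (v : Fin n → E) :
    antiSum (conjForm η) v = 2 ^ n * conj (η v) := by
  refine antiSum_of_antilinear _ _ fun c => ?_
  have : η (fun i => c i • v i) = (∏ i, c i) • η v := η.toMultilinearMap.map_smul_univ c v
  simp [this]

/-- An alternating form is of type `(0, n)` if it is conjugate linear in each argument. -/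
def IsAntiAlternating {E : Type*} [NormedAddCommGroup E] [NormedSpace ℂ E] {n : ℕ}
    (τ : E [⋀^Fin n]→L[ℝ] ℂ) : Prop :=
  ∀ (v : Fin n → E) (i : Fin n), τ (Function.update v i (I • v i)) = -I * τ v

theorem isAntiAlternating_conjForm {E : Type*} [NormedAddCommGroup E] [NormedSpace ℂ E] {n : ℕ}
    (η : E [⋀^Fin n]→L[ℂ] ℂ) : IsAntiAlternating (conjForm η) := by
  intro v i
  rw [conjForm_apply, η.map_update_smul, Function.update_eq_self]
  simp

/-- The conjugate of a form of type `(0, n)`, as a complex alternating form. -/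
def IsAntiAlternating.conj {E : Type*} [NormedAddCommGroup E] [NormedSpace ℂ E] {n : ℕ}
    {τ : E [⋀^Fin n]→L[ℝ] ℂ} (h : IsAntiAlternating τ) : E [⋀^Fin n]→ₗ[ℂ] ℂ where
  toFun v := starRingEnd ℂ (τ v)
  map_update_add' := by
    intro dec v i x y
    obtain rfl : dec = instDecidableEqFin _ := Subsingleton.elim _ _
    rw [τ.map_update_add, map_add]
  map_update_smul' := by
    intro dec v i c x
    obtain rfl : dec = instDecidableEqFin _ := Subsingleton.elim _ _
    have hr : ∀ (r : ℝ) (x : E), τ (Function.update v i ((r : ℂ) • x)) =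
        r * τ (Function.update v i x) := fun r x => by
      simp
    have hI : ∀ x : E, τ (Function.update v i (I • x)) = -I * τ (Function.update v i x) :=
      fun x => by simpa using h (Function.update v i x) i
    have hc : starRingEnd ℂ c = c.re - c.im * I := by apply Complex.ext <;> simp
    have : τ (Function.update v i (c • x)) =
        starRingEnd ℂ c * τ (Function.update v i x) := by
      conv_lhs => rw [← re_add_im c, add_smul, τ.map_update_add, hr, mul_smul, hr, hI]
      rw [hc]
      ring
    simp [this]
  map_eq_zero_of_eq' v i j hv hij := by
    rw [τ.map_eq_zero_of_eq v hv hij, map_zero]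

theorem IsAntiAlternating.eq_smul_conjForm {τ : Model [⋀^Fin 3]→L[ℝ] ℂ}
    (h : IsAntiAlternating τ) : τ = τ stdFrame • conjForm detForm := by
  ext v
  have h1 := AlternatingMap.eq_smul_basis_det (Pi.basisFun ℂ (Fin 3)) h.conj
  have h2 := AlternatingMap.eq_smul_basis_det (Pi.basisFun ℂ (Fin 3)) detForm.toAlternatingMap
  have h3 : detForm.toAlternatingMap (Pi.basisFun ℂ (Fin 3)) = 1 := detForm_stdFrame
  rw [h3, one_smul] at h2
  rw [← h2] at h1
  have h4 := congrArg (starRingEnd ℂ) (congrArg (fun f : Model [⋀^Fin 3]→ₗ[ℂ] ℂ => f v) h1)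
  simp only [AlternatingMap.smul_apply, smul_eq_mul, map_mul] at h4
  change starRingEnd ℂ (starRingEnd ℂ (τ v)) =
    starRingEnd ℂ (starRingEnd ℂ (τ stdFrame)) * starRingEnd ℂ (detForm v) at h4
  simpa using h4

/-- The Cauchy-Riemann equations for the conjugate of the coefficient of a closed form of
type `(0, 3)`. -/
theorem differentiableAt_conj_of_extDeriv_eq_zero {a : Model → Model [⋀^Fin 3]→L[ℝ] ℂ} {y : Model}
    (ha : DifferentiableAt ℝ a y) (hanti : ∀ᶠ z in nhds y, IsAntiAlternating (a z))
    (hd : extDeriv a y = 0) : DifferentiableAt ℂ (fun z => conj (a z stdFrame)) y := by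
  have hap : ∀ w : Fin 3 → Model, DifferentiableAt ℝ (fun z => a z w) y := fun w =>
    ((ContinuousAlternatingMap.apply ℝ Model ℂ w).differentiableAt).comp y ha
  have hI : ∀ v, fderiv ℝ (fun z => a z stdFrame) y (I • v) =
      -I * fderiv ℝ (fun z => a z stdFrame) y v := by
    -- Closedness evaluated on `(v, e₁, e₂, e₃)` trades the derivative in direction `v` for
    -- derivatives in the directions `e_k` of coefficients in which `v` is an argument of `a`. There
    -- the conjugate linearity in `v` is known.
    have hsum : ∀ v, fderiv ℝ (fun z => a z stdFrame) y v =
        ∑ k : Fin 3, (-1 : ℂ) ^ (k : ℕ) *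
          fderiv ℝ (fun z => a z (Fin.cons v (k.removeNth stdFrame))) y (stdFrame k) := by
      intro v
      have h := extDeriv_apply ha (Fin.cons v stdFrame)
      rw [hd, Fin.sum_univ_succ] at h
      have h1 : ∀ k : Fin 3, k.succ.removeNth (Fin.cons v stdFrame : Fin 4 → Model) =
          Fin.cons v (k.removeNth stdFrame) := by
        intro k
        funext j
        refine Fin.cases ?_ (fun j => ?_) j <;> simp [Fin.removeNth]
      simp only [h1, Fin.cons_succ, Fin.cons_zero, Fin.removeNth_zero, Fin.tail_cons,
        Fin.val_zero, pow_zero, one_smul, Fin.val_succ, pow_succ, mul_neg, mul_one, neg_smul,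
        Finset.sum_neg_distrib] at h
      have h2 : fderiv ℝ (fun z => a z stdFrame) y v = ∑ k : Fin 3, (-1 : ℤ) ^ (k : ℕ) •
          fderiv ℝ (fun z => a z (Fin.cons v (k.removeNth stdFrame))) y (stdFrame k) := by
        have h3 : (0 : ℂ) = _ := h
        linear_combination -h3
      rw [h2]
      exact Finset.sum_congr rfl fun k _ => by simp
    intro v
    rw [hsum, hsum v, Finset.mul_sum]
    refine Finset.sum_congr rfl fun k _ => ?_
    have heq : (fun z => a z (Fin.cons (I • v) (k.removeNth stdFrame))) =ᶠ[nhds y]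
        fun z => -I * a z (Fin.cons v (k.removeNth stdFrame)) := by
      filter_upwards [hanti] with z hz
      have := hz (Fin.cons v (k.removeNth stdFrame)) 0
      rwa [Fin.cons_zero, Fin.update_cons_zero] at this
    rw [heq.fderiv_eq, fderiv_const_mul (hap _)]
    simp
    ring
  have hreal : HasFDerivAt (fun z => conj (a z stdFrame))
      ((conjCLE : ℂ →L[ℝ] ℂ).comp (fderiv ℝ (fun z => a z stdFrame) y)) y :=
    (conjCLE : ℂ →L[ℝ] ℂ).hasFDerivAt.comp y (hap _).hasFDerivAt
  have hlin : ∀ (c : ℂ) (v : Model),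
      conj (fderiv ℝ (fun z => a z stdFrame) y (c • v)) =
        c * conj (fderiv ℝ (fun z => a z stdFrame) y v) := by
    intro c v
    have hr : ∀ (r : ℝ) (v : Model), fderiv ℝ (fun z => a z stdFrame) y ((r : ℂ) • v) =
        r * fderiv ℝ (fun z => a z stdFrame) y v := fun r v => by
      simp
    conv_lhs => rw [← re_add_im c, add_smul, map_add, hr, mul_smul, hr, hI]
    simp
    linear_combination conj (fderiv ℝ (fun z => a z stdFrame) y v) * re_add_im c
  let L : Model →L[ℂ] ℂ :=
    LinearMap.toContinuousLinearMap
      { toFun := fun v => conj (fderiv ℝ (fun z => a z stdFrame) y v)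
        map_add' := fun v w => by simp
        map_smul' := fun c v => by simpa using hlin c v }
  refine (differentiableAt_iff_restrictScalars ℝ hreal.differentiableAt).2 ⟨L, ?_⟩
  rw [hreal.fderiv]
  ext v
  rfl

/-- The form is the conjugate of `d(h dz₁ ∧ dz₂ ∧ dz₃)`, a complex alternating 4-form on a space of
dimension 3. -/
theorem extDeriv_conj_smul_eq_zero {h : Model → ℂ} {y : Model} (hh : DifferentiableAt ℂ h y) :
    extDeriv (fun z => conj (h z) • conjForm detForm) y = 0 := by
  have h1 : HasFDerivAt (fun z => conj (h z))
      ((conjCLE : ℂ →L[ℝ] ℂ).comp ((fderiv ℂ h y).restrictScalars ℝ)) y :=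
    (conjCLE : ℂ →L[ℝ] ℂ).hasFDerivAt.comp y (hh.hasFDerivAt.restrictScalars ℝ)
  have h2 := h1.smul_const (conjForm detForm)
  ext v
  rw [extDeriv, h2.fderiv, ContinuousAlternatingMap.alternatizeUncurryFin_apply]
  let B := ContinuousAlternatingMap.alternatizeUncurryFin ((fderiv ℂ h y).smulRight detForm)
  have hB : B v = 0 := by
    refine B.toAlternatingMap.map_linearDependent v fun hv => ?_
    have := hv.fintype_card_le_finrank
    simp at this
  rw [ContinuousAlternatingMap.alternatizeUncurryFin_apply] at hB
  have := congrArg conj hB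
  simpa using this

end VolumeForms

/-! ### The holomorphic volume form and H^{0,3} -/

section GlobalForms

open Complex ComplexConjugate

variable {X : Type*} [TopologicalSpace X] [ChartedSpace Model X]

/-- The value of a form of type `(3, 0)` on the standard frame of the tangent space, which is
identified with `ℂ³` by means of the preferred chart. -/
def Form.coeff (η : Form ℂ X 3) (x : X) : ℂ := (η x : Model [⋀^Fin 3]→L[ℂ] ℂ) stdFrame

theorem Form.apply_eq_coeff_smul (η : Form ℂ X 3) (x : X) : η x = η.coeff x • detForm :=
  alternating_eq_smul_detForm _

theorem Form.coeff_ne_zero {η : Form ℂ X 3} {x : X} (h : η x ≠ 0) : η.coeff x ≠ 0 :=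
  fun h0 => h ((alternating_eq_zero_iff _).1 h0)

/-- The coefficient of a form of type `(3, 0)` in the coordinates of `e`. -/
def Form.coeffIn (η : Form ℂ X 3) (e : OpenPartialHomeomorph X Model) (y : Model) : ℂ :=
  η.inCoordinates e y stdFrame

theorem Form.coeffIn_eq (η : Form ℂ X 3) (e : OpenPartialHomeomorph X Model) (y : Model) :
    η.coeffIn e y = LinearMap.det (symmDeriv e y : Model →ₗ[ℂ] Model) * η.coeff (e.symm y) :=
  η.inCoordinates_stdFrame e y

theorem Form.inCoordinates_eq (η : Form ℂ X 3) (e : OpenPartialHomeomorph X Model) (y : Model) :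
    η.inCoordinates e y = η.coeffIn e y • detForm := alternating_eq_smul_detForm _

theorem Form.IsHolomorphic.differentiableOn_coeffIn {η : Form ℂ X 3} (hη : η.IsHolomorphic)
    {e : OpenPartialHomeomorph X Model} (he : e ∈ atlas Model X) :
    DifferentiableOn ℂ (η.coeffIn e) e.target := fun y hy =>
  (ContinuousAlternatingMap.apply ℂ Model ℂ stdFrame).differentiableAt.comp_differentiableWithinAt
    y (hη e he y hy)

/-- The complex conjugate of a form of type `(p, 0)`. -/
def Form.conjugate {p : ℕ} (η : Form ℂ X p) : Form ℝ X p := fun x =>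
  (conjForm (E := Model) (η x : Model [⋀^Fin p]→L[ℂ] ℂ) : Model [⋀^Fin p]→L[ℝ] ℂ)

theorem Form.conjugate_pullback {η : Form ℂ X 3} {g : X → X} (hg : MDifferentiable 𝓘(ℂ, Model) 𝓘(ℂ, Model) g) :
    η.conjugate.pullback g = (η.pullback g).conjugate := by
  funext x
  have h := mfderiv_restrictScalars (hg x)
  have h1 : η.conjugate.pullback g x = (η.conjugate (g x) :
    Model [⋀^Fin 3]→L[ℝ] ℂ).compContinuousLinearMap
      (mfderiv 𝓘(ℝ, Model) 𝓘(ℝ, Model) g x : Model →L[ℝ] Model) := rfl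
  rw [h1, h]
  rfl

variable [IsManifold 𝓘(ℂ, Model) ω X] {η : Form ℂ X 3}

theorem Form.coeffIn_ne_zero (h0 : ∀ x, η x ≠ 0) {e : OpenPartialHomeomorph X Model}
    (he : e ∈ atlas Model X) {y : Model} (hy : y ∈ e.target) : η.coeffIn e y ≠ 0 := by
  rw [η.coeffIn_eq]
  exact mul_ne_zero (det_symmDeriv_ne_zero he hy) (Form.coeff_ne_zero (h0 _))

theorem Form.conjugate_inCoordinates {e : OpenPartialHomeomorph X Model} (he : e ∈ atlas Model X)
    {y : Model} (hy : y ∈ e.target) : η.conjugate.inCoordinates e y =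
      conj (η.coeffIn e y) • conjForm detForm := by
  rw [Form.inCoordinates_real _ he hy, ← conjForm_smul, ← Form.inCoordinates_eq]
  rfl

theorem Form.IsHolomorphic.representsH0_conjugate (hη : η.IsHolomorphic) :
    η.conjugate.RepresentsH0 := by
  refine ⟨fun e he => ?_, fun e he y hy => ?_, fun x v i => ?_⟩
  · refine ContDiffOn.congr (f := fun y => conj (η.coeffIn e y) • conjForm detForm) ?_
      fun y hy => Form.conjugate_inCoordinates he hy
    have h1 : ContDiffOn ℝ ∞ (η.coeffIn e) e.target :=
      (contDiffOn_of_differentiableOn e.open_target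
        (hη.differentiableOn_coeffIn he)).restrict_scalars ℝ
    exact ((conjCLE : ℂ →L[ℝ] ℂ).contDiff.comp_contDiffOn h1).smul contDiffOn_const
  · have h1 : η.conjugate.inCoordinates e =ᶠ[nhds y]
        fun y => conj (η.coeffIn e y) • conjForm detForm := by
      filter_upwards [e.open_target.mem_nhds hy] with z hz
      exact Form.conjugate_inCoordinates he hz
    rw [h1.extDeriv_eq, extDeriv_conj_smul_eq_zero
      ((hη.differentiableOn_coeffIn he).differentiableAt (e.open_target.mem_nhds hy))]
    rfl
  · exact isAntiAlternating_conjForm _ v i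

theorem det_eq_matrix_det (A : Model →L[ℂ] Model) : LinearMap.det (A : Model →ₗ[ℂ] Model) =
    Matrix.det fun i j => A (stdFrame j) i := by
  rw [← LinearMap.det_toMatrix (Pi.basisFun ℂ (Fin 3))]
  congr 1
  ext i j
  simp [stdFrame]

/-- The Jacobian determinant is a polynomial in the partial derivatives, which are holomorphic
again. -/
theorem differentiableOn_det_fderiv {φ : Model → Model} {s : Set Model} (hs : IsOpen s)
    (hφ : DifferentiableOn ℂ φ s) :
    DifferentiableOn ℂ (fun y => LinearMap.det (fderiv ℂ φ y : Model →ₗ[ℂ] Model)) s := by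
  have h : ∀ i j, DifferentiableOn ℂ (fun y => fderiv ℂ φ y (stdFrame j) i) s := fun i j =>
    differentiableOn_pi.1 (differentiableOn_fderiv_apply hs hφ (stdFrame j)) i
  have h2 : (fun y => LinearMap.det (fderiv ℂ φ y : Model →ₗ[ℂ] Model)) = fun y =>
      ∑ σ : Equiv.Perm (Fin 3), (Equiv.Perm.sign σ : ℂ) *
        ∏ i, fderiv ℂ φ y (stdFrame i) (σ i) := by
    funext y
    exact (det_eq_matrix_det _).trans (Matrix.det_apply' _)
  rw [h2]
  simp only [Fin.prod_univ_three]
  exact DifferentiableOn.fun_sum fun σ _ =>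
    (((h _ _).fun_mul (h _ _)).fun_mul (h _ _)).const_mul _

theorem Form.coeff_pullback_mul_det {g : X → X} {e e' : OpenPartialHomeomorph X Model}
    {y : Model} (he : e ∈ atlas Model X) (he' : e' ∈ atlas Model X)
    (hg : MDifferentiableAt 𝓘(ℂ, Model) 𝓘(ℂ, Model) g (e.symm y))
    (hy : y ∈ e.target) (hy' : g (e.symm y) ∈ e'.source) :
    (η.pullback g).coeffIn e y =
      LinearMap.det (fderiv ℂ (e' ∘ g ∘ e.symm) y : Model →ₗ[ℂ] Model) *
        η.coeffIn e' ((e' ∘ g ∘ e.symm) y) := by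
  have h1 := mfderiv_comp_symmDeriv he he' hg hy hy'
  have h2 : (η.pullback g).coeffIn e y = (η (g (e.symm y)) : Model [⋀^Fin 3]→L[ℂ] ℂ)
      (((symmDeriv e' (e' (g (e.symm y)))).comp (fderiv ℂ (e' ∘ g ∘ e.symm) y)) ∘ stdFrame) :=
    congrArg (fun A : Model →L[ℂ] Model =>
      (η (g (e.symm y)) : Model [⋀^Fin 3]→L[ℂ] ℂ) (A ∘ stdFrame)) h1
  have h3 := alternating_apply_comp
    (η.inCoordinates e' (e' (g (e.symm y)))) (fderiv ℂ (e' ∘ g ∘ e.symm) y)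
  rw [Form.inCoordinates_complex, e'.left_inv hy'] at h3
  exact h2.trans h3

/-- A holomorphic self-map multiplies the holomorphic volume form by a constant. -/
theorem exists_pullback_eq_smul [CompactSpace X] [ConnectedSpace X] (hη : η.IsHolomorphic)
    (h0 : ∀ x, η x ≠ 0) {g : X → X} (hg : MDifferentiable 𝓘(ℂ, Model) 𝓘(ℂ, Model) g) :
    ∃ c : ℂ, ∀ x, (η.pullback g) x = c • η x := by
  -- The preferred frame need not vary continuously with `x`, so neither coefficient is regular by
  -- itself. In a chart `e` both acquire the same factor, the determinant of `symmDeriv e`, and only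
  -- the quotient is a holomorphic function on `X`.
  obtain ⟨c, hc⟩ := exists_eq_const_of_differentiableOn
    (f := fun x => (η.pullback g).coeff x / η.coeff x) fun e he => by
      intro y₀ hy₀
      refine DifferentiableAt.differentiableWithinAt ?_
      set e' := chartAt Model (g (e.symm y₀)) with he'
      have he'a : e' ∈ atlas Model X := chart_mem_atlas _ _
      have hev := eventually_coordinates (hg _).continuousAt hy₀
        (mem_chart_source Model (g (e.symm y₀)))
      obtain ⟨s, hs, hso, hys⟩ := eventually_nhds_iff.1 hev
      have hφ : DifferentiableOn ℂ (e' ∘ g ∘ e.symm) s := fun y hy =>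
        (mdifferentiableAt_coordinates he he'a (hg _) (hs y hy).1
          (hs y hy).2).differentiableWithinAt
      have hφ₀ := hφ.differentiableAt (hso.mem_nhds hys)
      have h1 : (fun x => (η.pullback g).coeff x / η.coeff x) ∘ e.symm =ᶠ[nhds y₀] fun y =>
          LinearMap.det (fderiv ℂ (e' ∘ g ∘ e.symm) y : Model →ₗ[ℂ] Model) *
            η.coeffIn e' ((e' ∘ g ∘ e.symm) y) * (η.coeffIn e y)⁻¹ := by
        filter_upwards [hso.mem_nhds hys] with y hy
        rw [← div_eq_mul_inv, ← Form.coeff_pullback_mul_det he he'a (hg _) (hs y hy).1 (hs y hy).2,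
          Form.coeffIn_eq, Form.coeffIn_eq,
          mul_div_mul_left _ _ (det_symmDeriv_ne_zero he (hs y hy).1)]
        rfl
      refine DifferentiableAt.congr_of_eventuallyEq ?_ h1
      have hd1 := (differentiableOn_det_fderiv hso hφ).differentiableAt (hso.mem_nhds hys)
      have hd2 : DifferentiableAt ℂ (η.coeffIn e' ∘ (e' ∘ g ∘ e.symm)) y₀ :=
        ((hη.differentiableOn_coeffIn he'a).differentiableAt
          (e'.open_target.mem_nhds (e'.map_source (hs _ hys).2))).comp y₀ hφ₀
      have hd3 := (hη.differentiableOn_coeffIn he).differentiableAt (e.open_target.mem_nhds hy₀)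
      exact (hd1.fun_mul hd2).fun_mul (hd3.inv (Form.coeffIn_ne_zero h0 he hy₀))
  refine ⟨c, fun x => ?_⟩
  have := hc x
  rw [div_eq_iff (Form.coeff_ne_zero (h0 x))] at this
  rw [(η.pullback g).apply_eq_coeff_smul, η.apply_eq_coeff_smul, this, mul_smul]
  rfl

/-- The closed smooth forms of type `(0, 3)` are the multiples of the conjugate of the holomorphic
volume form. -/
theorem Form.RepresentsH0.exists_eq_smul_conjugate [CompactSpace X] [ConnectedSpace X]
    (hη : η.IsHolomorphic) (h0 : ∀ x, η x ≠ 0) {α : Form ℝ X 3} (hα : α.RepresentsH0) :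
    ∃ k : ℂ, ∀ x, α x = k • η.conjugate x := by
  have hanti : ∀ x, IsAntiAlternating (α x : Model [⋀^Fin 3]→L[ℝ] ℂ) := fun x v i =>
    hα.2.2 x v i
  -- The differential of the chart is complex linear, so pulling back a (0, 3)-form multiplies its
  -- coefficient by the conjugate of the complex determinant.
  have hcoord : ∀ e ∈ atlas Model X, ∀ y ∈ e.target, α.inCoordinates e y =
      ((α (e.symm y) : Model [⋀^Fin 3]→L[ℝ] ℂ) stdFrame *
        conj (LinearMap.det (symmDeriv e y : Model →ₗ[ℂ] Model))) • conjForm detForm := by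
    intro e he y hy
    rw [Form.inCoordinates_real _ he hy, mul_smul, ← conjForm_smul]
    have h1 : (LinearMap.det (symmDeriv e y : Model →ₗ[ℂ] Model)) • detForm =
        detForm.compContinuousLinearMap (symmDeriv e y) := by
      rw [alternating_eq_smul_detForm (detForm.compContinuousLinearMap _)]
      congr 1
      exact ((alternating_apply_comp detForm (symmDeriv e y)).trans
        (by rw [detForm_stdFrame, mul_one])).symm
    rw [h1]
    conv_lhs => rw [(hanti (e.symm y)).eq_smul_conjForm]
    rfl
  -- By the Cauchy-Riemann equations it is the conjugate of the coefficient of `α` that is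
  -- holomorphic; hence the constant has to be conjugated at the end.
  obtain ⟨k, hk⟩ := exists_eq_const_of_differentiableOn
    (f := fun x => conj ((α x : Model [⋀^Fin 3]→L[ℝ] ℂ) stdFrame) / η.coeff x) fun e he => by
      intro y₀ hy₀
      have h1 : DifferentiableAt ℂ (fun z => conj (α.inCoordinates e z stdFrame)) y₀ := by
        refine differentiableAt_conj_of_extDeriv_eq_zero ?_ ?_ ?_
        · exact ((hα.1 e he).differentiableOn (by simp)).differentiableAt
            (e.open_target.mem_nhds hy₀)
        · filter_upwards [e.open_target.mem_nhds hy₀] with z hz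
          rw [hcoord e he z hz, ← conj_conj ((α (e.symm z) : Model [⋀^Fin 3]→L[ℝ] ℂ) stdFrame),
            ← map_mul, ← conjForm_smul]
          exact isAntiAlternating_conjForm _
        · rw [hα.2.1 e he y₀ hy₀]
          rfl
      have h2 := h1.fun_mul (((hη.differentiableOn_coeffIn he).differentiableAt
        (e.open_target.mem_nhds hy₀)).inv (Form.coeffIn_ne_zero h0 he hy₀))
      refine (h2.congr_of_eventuallyEq ?_).differentiableWithinAt
      filter_upwards [e.open_target.mem_nhds hy₀] with y hy
      change _ = _ * (η.coeffIn e y)⁻¹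
      rw [← div_eq_mul_inv, hcoord e he y hy, Form.coeffIn_eq, ContinuousAlternatingMap.smul_apply, conjForm_apply,
        detForm_stdFrame, map_one, smul_eq_mul, mul_one, map_mul, conj_conj,
        mul_comm (conj _), mul_div_mul_left _ _ (det_symmDeriv_ne_zero he hy)]
      rfl
  refine ⟨conj k, fun x => ?_⟩
  have h1 := hk x
  rw [div_eq_iff (Form.coeff_ne_zero (h0 x))] at h1
  have h2 : (α x : Model [⋀^Fin 3]→L[ℝ] ℂ) stdFrame = conj k * conj (η.coeff x) := by
    rw [← map_mul, ← h1, conj_conj]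
  have h3 : (η.conjugate x : Model [⋀^Fin 3]→L[ℝ] ℂ) =
      conj (η.coeff x) • conjForm detForm := by
    rw [← conjForm_smul]
    exact congrArg conjForm (Form.apply_eq_coeff_smul η x)
  have h4 := (hanti x).eq_smul_conjForm
  exact h4.trans ((congrArg (· • conjForm detForm) h2).trans
    ((mul_smul _ _ _).trans (congrArg (conj k • ·) h3.symm)))

/-- Representatives of classes in `H^{0,3}` are multiples of the conjugate of `η`, hence are fixed
by `g^*` as forms, and 0 serves as the primitive of the difference. -/
theorem isSymplectic_of_pullback_eq [CompactSpace X] [ConnectedSpace X] (hη : η.IsHolomorphic)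
    (h0 : ∀ x, η x ≠ 0) {g : X → X} (hg : MDifferentiable 𝓘(ℂ, Model) 𝓘(ℂ, Model) g)
    (h : η.pullback g = η) : IsSymplectic g := by
  intro α hα
  obtain ⟨k, hk⟩ := hα.exists_eq_smul_conjugate hη h0
  have h1 : α = fun x => k • η.conjugate x := funext hk
  have h2 : α.pullback g = α := by
    have h3 : α.pullback g = fun x => k • η.conjugate.pullback g x := by
      rw [h1]; rfl
    rw [h3, Form.conjugate_pullback hg, h, h1]
  have hz : ∀ e : OpenPartialHomeomorph X Model, (0 : Form ℝ X 2).inCoordinates e = 0 :=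
    fun e => rfl
  refine ⟨0, fun e he => ?_, fun e he y hy => ?_⟩
  · rw [hz]
    exact contDiffOn_const
  · rw [h2, sub_self, hz]
    have : (0 : Form ℝ X 3).inCoordinates e y = 0 := rfl
    rw [this, extDeriv]
    simp
    ext v
    simp [ContinuousAlternatingMap.alternatizeUncurryFin_apply]

end GlobalForms

/-! ### Stokes' theorem on ℂ³ -/

section LocalStokes

open Complex ComplexConjugate MeasureTheory

/-- Integration by parts against the constant function 1. -/
theorem integral_fderiv_apply_eq_zero {f : Model → ℂ} (hf : ContDiff ℝ 1 f)
    (hc : HasCompactSupport f) (v : Model) : ∫ y, fderiv ℝ f y v = 0 := by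
  have h := integral_mul_fderiv_eq_neg_fderiv_mul_of_integrable (μ := (volume : Measure Model))
    (f := fun _ => (1 : ℂ)) (g := f) (v := v) (by simp) ?_ ?_ (fun _ _ => by fun_prop)
    (fun x _ => (hf.differentiable one_ne_zero) x)
  · simpa using h
  · simp only [one_mul]
    exact ((hf.continuous_fderiv one_ne_zero).clm_apply
      continuous_const).integrable_of_hasCompactSupport (hc.fderiv_apply ℝ v)
  · simpa using hf.continuous.integrable_of_hasCompactSupport hc

variable {F : Model → Model [⋀^Fin 2]→L[ℝ] ℂ}

/-- For a fixed frame `v` this is a combination with constant coefficients of directional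
derivatives of scalar functions, each of which integrates to 0 when `F` has compact support. -/
theorem antiSum_extDeriv_eq (hF : ContDiff ℝ 1 F) (v : Fin 3 → Model) (y : Model) :
    antiSum (extDeriv F y) v = ∑ s : Fin 3 → Fin 2, (∏ i, I ^ (s i : ℕ)) *
      ∑ i : Fin 3, (-1) ^ (i : ℕ) * fderiv ℝ
        (fun z => F z (i.removeNth fun j => I ^ (s j : ℕ) • v j)) y (I ^ (s i : ℕ) • v i) := by
  simp only [antiSum, extDeriv_apply (hF.differentiable one_ne_zero y)]
  simp

theorem contDiff_alternating_apply (hF : ContDiff ℝ 1 F) (w : Fin 2 → Model) :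
    ContDiff ℝ 1 fun z => F z w :=
  (ContinuousAlternatingMap.apply ℝ Model ℂ w).contDiff.comp hF

theorem hasCompactSupport_alternating_apply (hc : HasCompactSupport F) (w : Fin 2 → Model) :
    HasCompactSupport fun z => F z w :=
  hc.comp_left (g := fun τ : Model [⋀^Fin 2]→L[ℝ] ℂ => τ w) rfl

theorem integrable_fderiv_alternating_apply (hF : ContDiff ℝ 1 F) (hc : HasCompactSupport F)
    (w : Fin 2 → Model) (v : Model) : Integrable fun y => fderiv ℝ (fun z => F z w) y v :=
  (((contDiff_alternating_apply hF w).continuous_fderiv one_ne_zero).clm_apply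
    continuous_const).integrable_of_hasCompactSupport
      ((hasCompactSupport_alternating_apply hc w).fderiv_apply ℝ v)

theorem integrable_antiSum_extDeriv (hF : ContDiff ℝ 1 F) (hc : HasCompactSupport F)
    (v : Fin 3 → Model) : Integrable fun y => antiSum (extDeriv F y) v := by
  simp only [antiSum_extDeriv_eq hF]
  exact integrable_finsetSum _ fun s _ => (integrable_finsetSum _ fun i _ =>
    (integrable_fderiv_alternating_apply hF hc _ _).const_mul _).const_mul _

/-- Stokes' theorem for a form with compact support on `ℂ³`. -/
theorem integral_antiSum_extDeriv_eq_zero (hF : ContDiff ℝ 1 F) (hc : HasCompactSupport F)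
    (v : Fin 3 → Model) : ∫ y, antiSum (extDeriv F y) v = 0 := by
  simp only [antiSum_extDeriv_eq hF]
  rw [integral_finsetSum _ fun s _ => (integrable_finsetSum _ fun i _ =>
    (integrable_fderiv_alternating_apply hF hc _ _).const_mul _).const_mul _]
  refine Finset.sum_eq_zero fun s _ => ?_
  rw [integral_const_mul, integral_finsetSum _ fun i _ =>
    (integrable_fderiv_alternating_apply hF hc _ _).const_mul _]
  rw [Finset.sum_eq_zero, mul_zero]
  intro i _
  rw [integral_const_mul, integral_fderiv_apply_eq_zero (contDiff_alternating_apply hF _)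
    (hasCompactSupport_alternating_apply hc _), mul_zero]

variable {Ω K : Set Model} {r : Model → ℝ} {h : Model → ℂ} {b : Model → Model [⋀^Fin 2]→L[ℝ] ℂ}

/-- The Leibniz rule for the `(0, 3)`-component of `d(r h b)`, where `h` is holomorphic. -/
theorem antiSum_extDeriv_smul {y : Model} (hr : DifferentiableAt ℝ r y)
    (hh : DifferentiableAt ℂ h y) (hb : DifferentiableAt ℝ b y) (v : Fin 3 → Model) :
    antiSum (extDeriv (fun z => r z • h z • b z) y) v =
      h y * antiSum (ContinuousAlternatingMap.alternatizeUncurryFin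
        ((fderiv ℝ r y).smulRight (b y))) v + r y * h y * antiSum (extDeriv b y) v := by
  have h1 : HasFDerivAt (fun z => r z • h z • b z) _ y :=
    hr.hasFDerivAt.smul ((hh.hasFDerivAt.restrictScalars ℝ).smul hb.hasFDerivAt)
  set L₁ := (fderiv ℝ r y).smulRight (b y)
  set L₂ := ((fderiv ℂ h y).restrictScalars ℝ).smulRight (b y)
  have h2 : extDeriv (fun z => r z • h z • b z) y =
      h y • ContinuousAlternatingMap.alternatizeUncurryFin L₁ +
        ((r y : ℂ) • ContinuousAlternatingMap.alternatizeUncurryFin L₂ +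
          ((r y : ℂ) * h y) • extDeriv b y) := by
    rw [extDeriv, h1.fderiv, extDeriv]
    ext w
    simp only [ContinuousAlternatingMap.add_apply, ContinuousAlternatingMap.smul_apply,
      ContinuousAlternatingMap.alternatizeUncurryFin_apply, Finset.smul_sum, L₁, L₂,
      ← Finset.sum_add_distrib]
    refine Finset.sum_congr rfl fun i _ => ?_
    simp
    ring
  -- `dh` is complex linear, so `dh ∧ b` has no (0, 3)-component.
  have h3 : antiSum (ContinuousAlternatingMap.alternatizeUncurryFin L₂) v = 0 := by
    refine antiSum_alternatizeUncurryFin_eq_zero _ (fun u => ?_) v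
    simp [L₂, mul_smul]
  rw [h2, antiSum_add, antiSum_add, antiSum_smul, antiSum_smul, antiSum_smul, h3]
  ring

/-- Extension by zero is harmless: the extended form is smooth on `Ω` and vanishes on the complement
of `K`, and these two open sets cover the space. -/
theorem contDiff_indicator_smul (hΩ : IsOpen Ω) (hK : IsCompact K) (hKΩ : K ⊆ Ω)
    (hr : ContDiffOn ℝ ∞ r Ω) (hrK : ∀ y ∈ Ω, y ∉ K → r y = 0)
    (hh : DifferentiableOn ℂ h Ω) (hb : ContDiffOn ℝ ∞ b Ω) :
    ContDiff ℝ 1 (Ω.indicator fun z => r z • h z • b z) ∧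
      HasCompactSupport (Ω.indicator fun z => r z • h z • b z) ∧
      ∀ y ∉ Ω, extDeriv (Ω.indicator fun z => r z • h z • b z) y = 0 := by
  set F := Ω.indicator fun z => r z • h z • b z with hF
  have hFK : ∀ y ∉ K, F y = 0 := by
    intro y hy
    by_cases hyΩ : y ∈ Ω
    · rw [hF, Set.indicator_of_mem hyΩ, hrK y hyΩ hy]
      exact zero_smul ℝ (h y • b y)
    · rw [hF, Set.indicator_of_notMem hyΩ]
  have hev : ∀ y ∉ K, F =ᶠ[nhds y] 0 := fun y hy => by
    filter_upwards [hK.isClosed.isOpen_compl.mem_nhds hy] with z hz using hFK z hz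
  have hu : ContDiffOn ℝ ∞ (fun z => r z • h z • b z) Ω :=
    hr.smul (((contDiffOn_of_differentiableOn hΩ hh).restrict_scalars ℝ).smul hb)
  refine ⟨contDiff_iff_contDiffAt.2 fun y => ?_, HasCompactSupport.intro hK hFK, fun y hy => ?_⟩
  · by_cases hy : y ∈ K
    · have hyΩ := hΩ.mem_nhds (hKΩ hy)
      have h1 : F =ᶠ[nhds y] fun z => r z • h z • b z := by
        filter_upwards [hyΩ] with z hz
        rw [hF, Set.indicator_of_mem hz]
      exact ((hu.contDiffAt hyΩ).of_le (by norm_cast)).congr_of_eventuallyEq h1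
    · exact contDiffAt_const.congr_of_eventuallyEq (hev y hy)
  · have h1 : F =ᶠ[nhds y] 0 := hev y fun hyK => hy (hKΩ hyK)
    rw [extDeriv, h1.fderiv_eq]
    ext w
    simp [ContinuousAlternatingMap.alternatizeUncurryFin_apply]

/-- Stokes' theorem for `r h b` extended by zero. In the application `r` is a cutoff function, `h`
the coefficient of `η` and `b` a primitive, all in one chart; `G` is the integrand computed
intrinsically on the manifold. -/
theorem integral_local_stokes (hΩ : IsOpen Ω) (hK : IsCompact K) (hKΩ : K ⊆ Ω)
    (hr : ContDiffOn ℝ ∞ r Ω) (hrK : ∀ y ∈ Ω, y ∉ K → r y = 0)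
    (hh : DifferentiableOn ℂ h Ω) (hb : ContDiffOn ℝ ∞ b Ω) (v : Fin 3 → Model) {G : Model → ℂ}
    (hG : ∀ y ∈ Ω, G y = h y * antiSum (ContinuousAlternatingMap.alternatizeUncurryFin
        ((fderiv ℝ r y).smulRight (b y))) v + r y * h y * antiSum (extDeriv b y) v) :
    IntegrableOn G Ω ∧ ∫ y in Ω, G y = 0 := by
  obtain ⟨h1, h2, h3⟩ := contDiff_indicator_smul hΩ hK hKΩ hr hrK hh hb
  set F := Ω.indicator fun z => r z • h z • b z with hF
  have hGF : ∀ y ∈ Ω, G y = antiSum (extDeriv F y) v := by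
    intro y hy
    have h4 : F =ᶠ[nhds y] fun z => r z • h z • b z := by
      filter_upwards [hΩ.mem_nhds hy] with z hz
      rw [hF, Set.indicator_of_mem hz]
    rw [h4.extDeriv_eq, hG y hy, antiSum_extDeriv_smul]
    · exact (hr.differentiableOn (by simp)).differentiableAt (hΩ.mem_nhds hy)
    · exact hh.differentiableAt (hΩ.mem_nhds hy)
    · exact (hb.differentiableOn (by simp)).differentiableAt (hΩ.mem_nhds hy)
  constructor
  · exact (integrable_antiSum_extDeriv h1 h2 v).integrableOn.congr_fun
      (fun y hy => (hGF y hy).symm) hΩ.measurableSet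
  · rw [setIntegral_congr_fun hΩ.measurableSet hGF,
      setIntegral_eq_integral_of_forall_compl_eq_zero, integral_antiSum_extDeriv_eq_zero h1 h2]
    intro y hy
    rw [h3 y hy]
    simp [antiSum]

end LocalStokes

/-! ### Integration against |η|² and Stokes' theorem on X -/

section GlobalStokes

open Complex ComplexConjugate MeasureTheory

/-- The real Jacobian of a complex linear map is the squared modulus of its complex determinant.
This makes `|η|²` transform as a density. -/
theorem abs_det_restrictScalars (A : Model →L[ℂ] Model) :
    |(A.restrictScalars ℝ : Model →L[ℝ] Model).det| =
      normSq (LinearMap.det (A : Model →ₗ[ℂ] Model)) := by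
  have h := LinearMap.det_restrictScalars (R := ℝ) (f := (A : Model →ₗ[ℂ] Model))
  have h2 : (A.restrictScalars ℝ : Model →L[ℝ] Model).det =
      normSq (LinearMap.det (A : Model →ₗ[ℂ] Model)) := by
    rw [Algebra.norm_complex_eq] at h
    exact h
  rw [h2, abs_of_nonneg (normSq_nonneg _)]

/-- The wedge product of a real covector with an alternating form. -/
def wedge {n : ℕ} (ℓ : Model →L[ℝ] ℝ) (b : Model [⋀^Fin n]→L[ℝ] ℂ) :
    Model [⋀^Fin (n + 1)]→L[ℝ] ℂ :=
  ContinuousAlternatingMap.alternatizeUncurryFin (ℓ.smulRight b)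

theorem wedge_apply {n : ℕ} (ℓ : Model →L[ℝ] ℝ) (b : Model [⋀^Fin n]→L[ℝ] ℂ)
    (v : Fin (n + 1) → Model) :
    wedge ℓ b v = ∑ i : Fin (n + 1), (-1) ^ (i : ℕ) * (ℓ (v i) * b (i.removeNth v)) := by
  rw [wedge, ContinuousAlternatingMap.alternatizeUncurryFin_apply]
  simp

theorem antiSum_wedge_sum {n : ℕ} {ι : Type*} (t : Finset ι) (ℓ : ι → Model →L[ℝ] ℝ)
    (b : Model [⋀^Fin n]→L[ℝ] ℂ) (v : Fin (n + 1) → Model) :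
    ∑ i ∈ t, antiSum (wedge (ℓ i) b) v = antiSum (wedge (∑ i ∈ t, ℓ i) b) v := by
  simp only [antiSum, wedge_apply]
  rw [Finset.sum_comm]
  refine Finset.sum_congr rfl fun s _ => ?_
  rw [← Finset.mul_sum, Finset.sum_comm]
  congr 1
  refine Finset.sum_congr rfl fun i _ => ?_
  rw [← Finset.mul_sum, ← Finset.sum_mul]
  simp

theorem wedge_compContinuousLinearMap {n : ℕ} (ℓ : Model →L[ℝ] ℝ) (b : Model [⋀^Fin n]→L[ℝ] ℂ)
    (A : Model →L[ℝ] Model) : wedge (ℓ.comp A) (b.compContinuousLinearMap A) =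
      (wedge ℓ b).compContinuousLinearMap A := by
  ext v
  simp only [ContinuousAlternatingMap.compContinuousLinearMap_apply, wedge_apply]
  rfl

variable {X : Type*} [TopologicalSpace X] [ChartedSpace Model X]

/-- The integrand of a function with respect to the volume form `|η|²`, in a chart. -/
def volIntegrand (η : Form ℂ X 3) (e : OpenPartialHomeomorph X Model) (f : X → ℂ) (y : Model) :
    ℂ :=
  normSq (η.coeffIn e y) * f (e.symm y)

/-- The `(0, 3)`-component of `ℓ ∧ β`, divided by the conjugate of `η`. -/
def wedgeCoeff (η : Form ℂ X 3) (β : Form ℝ X 2) (ℓ : Model →L[ℝ] ℝ) (x : X) : ℂ :=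
  antiSum (wedge ℓ (β x : Model [⋀^Fin 2]→L[ℝ] ℂ)) stdFrame / conj (η.coeff x)

theorem wedgeCoeff_sum (η : Form ℂ X 3) (β : Form ℝ X 2) {ι : Type*} (t : Finset ι)
    (ℓ : ι → Model →L[ℝ] ℝ) (x : X) :
    ∑ i ∈ t, wedgeCoeff η β (ℓ i) x = wedgeCoeff η β (∑ i ∈ t, ℓ i) x := by
  simp only [wedgeCoeff, ← Finset.sum_div]
  exact congrArg (· / conj (η.coeff x)) (antiSum_wedge_sum t ℓ _ _)

theorem wedgeCoeff_zero (η : Form ℂ X 3) (β : Form ℝ X 2) (x : X) : wedgeCoeff η β 0 x = 0 :=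
  (wedgeCoeff_sum η β (∅ : Finset ℕ) (fun _ => 0) x).symm

/-- The differential of a real function. -/
def realDiff (ρ : X → ℝ) (x : X) : Model →L[ℝ] ℝ := mfderiv 𝓘(ℝ, Model) 𝓘(ℝ, ℝ) ρ x

variable [IsManifold 𝓘(ℂ, Model) ω X] {η : Form ℂ X 3} {e e' : OpenPartialHomeomorph X Model}

/-- The coefficient of `η` changes by the complex Jacobian determinant, hence its squared modulus by
the real one, exactly as the change of variables formula requires. The vanishing of `f` off the
overlap reduces both integrals to the overlap. -/
theorem volIntegrand_change_of_variables (he : e ∈ atlas Model X) (he' : e' ∈ atlas Model X)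
    {f : X → ℂ} (hf : ∀ x, x ∉ e.source ∩ e'.source → f x = 0) :
    (IntegrableOn (volIntegrand η e f) e.target →
      IntegrableOn (volIntegrand η e' f) e'.target) ∧
    ∫ y in e.target, volIntegrand η e f y = ∫ y in e'.target, volIntegrand η e' f y := by
  set S := (e.symm.trans e').source with hS
  set S' := (e'.symm.trans e).source with hS'
  have hmS : ∀ y, y ∈ S ↔ y ∈ e.target ∧ e.symm y ∈ e'.source := fun y => by simp [hS]
  have hmS' : ∀ y, y ∈ S' ↔ y ∈ e'.target ∧ e'.symm y ∈ e.source := fun y => by simp [hS']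
  have hSo : IsOpen S := (e.symm.trans e').open_source
  have hSo' : IsOpen S' := (e'.symm.trans e).open_source
  have himg : (e' ∘ e.symm) '' S = S' := by
    have := (e.symm.trans e').image_source_eq_target
    rwa [← OpenPartialHomeomorph.symm_source, OpenPartialHomeomorph.trans_symm_eq_symm_trans_symm,
      OpenPartialHomeomorph.symm_symm] at this
  have hinj : Set.InjOn (e' ∘ e.symm) S := (e.symm.trans e').injOn
  have hder : ∀ y ∈ S, HasFDerivWithinAt (e' ∘ e.symm)
      ((fderiv ℂ (e' ∘ e.symm) y).restrictScalars ℝ) S y := fun y hy =>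
    ((mdifferentiableAt_coordinates (g := id) he he' mdifferentiableAt_id ((hmS y).1 hy).1
      ((hmS y).1 hy).2).hasFDerivAt.restrictScalars ℝ).hasFDerivWithinAt
  have heq : ∀ y ∈ S, volIntegrand η e f y =
      |((fderiv ℂ (e' ∘ e.symm) y).restrictScalars ℝ : Model →L[ℝ] Model).det| •
        volIntegrand η e' f ((e' ∘ e.symm) y) := by
    intro y hy
    have hy' := (hmS y).1 hy
    have h1 : η.coeffIn e y = LinearMap.det (fderiv ℂ (e' ∘ e.symm) y : Model →ₗ[ℂ] Model) *
        η.coeffIn e' ((e' ∘ e.symm) y) := by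
      rw [Form.coeffIn_eq, Form.coeffIn_eq, symmDeriv_eq_comp he he' hy'.1 hy'.2,
        ContinuousLinearMap.toLinearMap_comp, LinearMap.det_comp, Function.comp_apply,
        e'.left_inv hy'.2]
      ring
    rw [abs_det_restrictScalars, volIntegrand, volIntegrand, h1, Function.comp_apply,
      e'.left_inv hy'.2, normSq_mul]
    simp
    ring
  have hz : ∀ y ∈ e.target \ S, volIntegrand η e f y = 0 := by
    rintro y ⟨hy, hyS⟩
    rw [volIntegrand, hf, mul_zero]
    exact fun h => hyS ((hmS y).2 ⟨hy, h.2⟩)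
  have hz' : ∀ y ∈ e'.target \ S', volIntegrand η e' f y = 0 := by
    rintro y ⟨hy, hyS⟩
    rw [volIntegrand, hf, mul_zero]
    exact fun h => hyS ((hmS' y).2 ⟨hy, h.1⟩)
  have hsub : S ⊆ e.target := fun y hy => ((hmS y).1 hy).1
  have hsub' : S' ⊆ e'.target := fun y hy => ((hmS' y).1 hy).1
  constructor
  · intro hi
    have h1 : IntegrableOn (volIntegrand η e' f) S' := by
      rw [← himg, integrableOn_image_iff_integrableOn_abs_det_fderiv_smul volume
        hSo.measurableSet hder hinj]
      exact (hi.mono_set hsub).congr_fun heq hSo.measurableSet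
    exact h1.of_forall_sdiff_eq_zero e'.open_target.measurableSet hz'
  · rw [setIntegral_eq_of_subset_of_forall_sdiff_eq_zero e.open_target.measurableSet hsub hz,
      setIntegral_eq_of_subset_of_forall_sdiff_eq_zero e'.open_target.measurableSet hsub' hz',
      ← himg, integral_image_eq_integral_abs_det_fderiv_smul volume hSo.measurableSet hder hinj]
    exact setIntegral_congr_fun hSo.measurableSet heq

/-- Under the differential of the chart the (0, 3)-component is multiplied by the conjugate
determinant, as is the conjugate coefficient of `η`. The quotient `wedgeCoeff` is thus independent
of the chart, and what remains is the density `|η|²`. -/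
theorem coeffIn_mul_antiSum (h0 : ∀ x, η x ≠ 0) (β : Form ℝ X 2) (he : e ∈ atlas Model X)
    {y : Model} (hy : y ∈ e.target) (ℓ : Model →L[ℝ] ℝ) :
    η.coeffIn e y * antiSum (wedge (ℓ.comp ((symmDeriv e y).restrictScalars ℝ))
      (β.inCoordinates e y)) stdFrame =
      normSq (η.coeffIn e y) * wedgeCoeff η β ℓ (e.symm y) := by
  have h1 : wedge (ℓ.comp ((symmDeriv e y).restrictScalars ℝ)) (β.inCoordinates e y) =
      (wedge ℓ (β (e.symm y) : Model [⋀^Fin 2]→L[ℝ] ℂ)).compContinuousLinearMap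
          ((symmDeriv e y).restrictScalars ℝ) := by
    rw [Form.inCoordinates_real β he hy]
    exact wedge_compContinuousLinearMap _ _ _
  have h2 := antiSum_comp_linearMap (wedge ℓ (β (e.symm y) : Model [⋀^Fin 2]→L[ℝ] ℂ))
    (Pi.basisFun ℂ (Fin 3)) (symmDeriv e y : Model →ₗ[ℂ] Model)
  rw [h1, antiSum_compContinuousLinearMap, wedgeCoeff]
  refine (congrArg (η.coeffIn e y * ·) h2).trans ?_
  have h3 : conj (η.coeff (e.symm y)) ≠ 0 := by
    simpa using Form.coeff_ne_zero (h0 (e.symm y))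
  rw [← mul_conj, η.coeffIn_eq, map_mul]
  field_simp

theorem fderiv_comp_symm {ρ : X → ℝ} (he : e ∈ atlas Model X) {y : Model} (hy : y ∈ e.target)
    (hρ : MDifferentiableAt 𝓘(ℝ, Model) 𝓘(ℝ, ℝ) ρ (e.symm y)) :
    (fderiv ℝ (ρ ∘ e.symm) y : Model →L[ℝ] ℝ) =
      (realDiff ρ (e.symm y)).comp ((symmDeriv e y).restrictScalars ℝ) := by
  set A : Model →L[ℝ] Model := (symmDeriv e y).restrictScalars ℝ
  have h0 : HasMFDerivAt 𝓘(ℝ, Model) 𝓘(ℝ, Model) e.symm y A :=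
    hasMFDerivAt_restrictScalars (hasMFDerivAt_symm he hy)
  have h1 : HasMFDerivAt 𝓘(ℝ, Model) 𝓘(ℝ, ℝ) (ρ ∘ e.symm) y ((realDiff ρ (e.symm y)).comp A) :=
    hρ.hasMFDerivAt.comp y h0
  exact mfderiv_eq_fderiv.symm.trans h1.mfderiv

theorem contDiffOn_comp_symm {ρ : X → ℝ} (he : e ∈ atlas Model X)
    (hρ : ContMDiff 𝓘(ℝ, Model) 𝓘(ℝ, ℝ) ∞ ρ) : ContDiffOn ℝ ∞ (ρ ∘ e.symm) e.target := by
  have : IsManifold 𝓘(ℂ, Model) ∞ X := inferInstance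
  have : IsManifold 𝓘(ℝ, Model) ∞ X := isManifold_restrictScalars ∞
  rw [← contMDiffOn_iff_contDiffOn]
  exact hρ.comp_contMDiffOn (contMDiffOn_symm_of_mem_maximalAtlas
    (IsManifold.subset_maximalAtlas he))

/-- Stokes' theorem for `ρ β` in a chart that contains the support of `ρ`. -/
theorem integral_chart_stokes [CompactSpace X] (hη : η.IsHolomorphic) (h0 : ∀ x, η x ≠ 0)
    {β : Form ℝ X 2} {κ : ℂ} (hβ : β.IsSmooth) (hd : β.HasExtDeriv fun x => κ • η.conjugate x)
    (he : e ∈ atlas Model X) {ρ : X → ℝ} (hρ : ContMDiff 𝓘(ℝ, Model) 𝓘(ℝ, ℝ) ∞ ρ)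
    (hsupp : tsupport ρ ⊆ e.source) {f : X → ℂ}
    (hf : ∀ x, f x = wedgeCoeff η β (realDiff ρ x) x + 8 * κ * ρ x) :
    IntegrableOn (volIntegrand η e f) e.target ∧ ∫ y in e.target, volIntegrand η e f y = 0 := by
  have hK : IsCompact (e '' tsupport ρ) :=
    (isClosed_tsupport ρ).isCompact.image_of_continuousOn (e.continuousOn.mono hsupp)
  have hKe : e '' tsupport ρ ⊆ e.target := by
    rintro _ ⟨x, hx, rfl⟩
    exact e.map_source (hsupp hx)
  refine integral_local_stokes e.open_target hK hKe (contDiffOn_comp_symm he hρ) ?_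
    (hη.differentiableOn_coeffIn he) (hβ e he) stdFrame ?_
  · intro y hy hyK
    by_contra hne
    exact hyK ⟨e.symm y, subset_tsupport ρ hne, e.right_inv hy⟩
  · intro y hy
    -- The 8 is the factor `2 ^ 3` by which `antiSum` exceeds the (0, 3)-component.
    have h1 : antiSum (extDeriv (β.inCoordinates e) y) stdFrame =
        8 * κ * conj (η.coeffIn e y) := by
      have h2 : Form.inCoordinates (fun x => κ • η.conjugate x) e y =
          (κ * conj (η.coeffIn e y)) • conjForm detForm := by
        rw [mul_smul, ← Form.conjugate_inCoordinates he hy]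
        rfl
      rw [hd e he y hy, h2, antiSum_smul, antiSum_conjForm, detForm_stdFrame]
      norm_num
      ring
    have h3 := coeffIn_mul_antiSum h0 β he hy
      (realDiff ρ (e.symm y))
    have h4 := fderiv_comp_symm he hy ((hρ (e.symm y)).mdifferentiableAt (by simp))
    rw [volIntegrand, hf, mul_add, h1]
    rw [h4]
    refine congrArg₂ (· + ·) h3.symm ?_
    rw [← mul_conj]
    simp only [Function.comp_apply]
    ring

theorem exists_finite_partitionOfUnity (X : Type*) [TopologicalSpace X] [ChartedSpace Model X]
    [IsManifold 𝓘(ℂ, Model) ω X] [CompactSpace X] [T2Space X] :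
    ∃ (n : ℕ) (e : Fin n → OpenPartialHomeomorph X Model) (ρ : Fin n → X → ℝ),
      (∀ i, e i ∈ atlas Model X) ∧ (∀ i, ContMDiff 𝓘(ℝ, Model) 𝓘(ℝ, ℝ) ∞ (ρ i)) ∧
      (∀ i, tsupport (ρ i) ⊆ (e i).source) ∧ (∀ i x, 0 ≤ ρ i x) ∧ ∀ x, ∑ i, ρ i x = 1 := by
  have : IsManifold 𝓘(ℂ, Model) ∞ X := inferInstance
  have : IsManifold 𝓘(ℝ, Model) ∞ X := isManifold_restrictScalars ∞
  obtain ⟨t, ht⟩ := isCompact_univ.elim_finite_subcover (fun x : X => (chartAt Model x).source)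
    (fun x => (chartAt Model x).open_source)
    (fun x _ => Set.mem_iUnion.2 ⟨x, mem_chart_source Model x⟩)
  let c : Fin t.card → X := fun i => (t.equivFin.symm i : X)
  have hc : (Set.univ : Set X) ⊆ ⋃ i, (chartAt Model (c i)).source := by
    intro x hx
    obtain ⟨z, hz, hxz⟩ := Set.mem_iUnion₂.1 (ht hx)
    refine Set.mem_iUnion.2 ⟨t.equivFin ⟨z, hz⟩, ?_⟩
    simpa [c] using hxz
  obtain ⟨f, hf⟩ := SmoothPartitionOfUnity.exists_isSubordinate 𝓘(ℝ, Model) isClosed_univ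
    (fun i => (chartAt Model (c i)).source) (fun i => (chartAt Model (c i)).open_source) hc
  refine ⟨t.card, fun i => chartAt Model (c i), fun i => f i, fun i => chart_mem_atlas _ _,
    fun i => (f i).contMDiff, hf, fun i x => f.nonneg i x, fun x => ?_⟩
  rw [← finsum_eq_sum_of_fintype]
  exact f.sum_eq_one (Set.mem_univ x)

/-- On a compact manifold the conjugate of a holomorphic volume form is not exact. -/
theorem eq_zero_of_hasExtDeriv [CompactSpace X] [T2Space X] [Nonempty X]
    (hη : η.IsHolomorphic) (h0 : ∀ x, η x ≠ 0) {β : Form ℝ X 2} {κ : ℂ} (hβ : β.IsSmooth)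
    (hd : β.HasExtDeriv fun x => κ • η.conjugate x) : κ = 0 := by
  obtain ⟨n, e, ρ, he, hρ, hsupp, hnn, hsum⟩ := exists_finite_partitionOfUnity X
  have hzero : ∀ i x, x ∉ (e i).source → ρ i x = 0 := fun i x hx =>
    image_eq_zero_of_notMem_tsupport fun h => hx (hsupp i h)
  -- `G i` is, up to the factor 8, the (0, 3)-part of `d(ρ i β)` divided by the conjugate of `η`.
  -- Its integral vanishes for each `i`, while the sum over `i` is the constant `8 κ`, because the
  -- differentials of the `ρ i` add up to 0.
  set G : Fin n → X → ℂ := fun i x => wedgeCoeff η β (realDiff (ρ i) x) x + 8 * κ * ρ i x with hG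
  have hI := fun i => integral_chart_stokes hη h0 hβ hd (he i) (hρ i) (hsupp i) (f := G i)
    fun x => rfl
  have hGzero : ∀ i x, x ∉ (e i).source → G i x = 0 := by
    intro i x hx
    have h1 : ρ i =ᶠ[nhds x] fun _ => 0 := by
      filter_upwards [(isClosed_tsupport (ρ i)).isOpen_compl.mem_nhds
        (fun h => hx (hsupp i h))] with z hz using image_eq_zero_of_notMem_tsupport hz
    have h2 : realDiff (ρ i) x = 0 := by
      have := h1.mfderiv_eq (I := 𝓘(ℝ, Model)) (I' := 𝓘(ℝ, ℝ))
      rw [mfderiv_const] at this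
      exact this
    simp only [hG, h2, hzero i x hx, wedgeCoeff_zero]
    simp
  have hGsum : ∀ x, ∑ i, G i x = 8 * κ := by
    intro x
    have h1 : ∑ i, realDiff (ρ i) x = 0 := by
      have h2 : HasMFDerivAt 𝓘(ℝ, Model) 𝓘(ℝ, ℝ) (∑ i, ρ i) x (∑ i, realDiff (ρ i) x) :=
        HasMFDerivAt.sum fun i _ => ((hρ i x).mdifferentiableAt (by simp)).hasMFDerivAt
      have h3 : (∑ i, ρ i) = fun _ => 1 := by
        funext z
        rw [Finset.sum_apply, hsum]
      rw [h3] at h2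
      have h4 := hasMFDerivAt_unique h2 (hasMFDerivAt_const (1 : ℝ) x)
      exact h4
    simp only [hG, Finset.sum_add_distrib, wedgeCoeff_sum, h1, wedgeCoeff_zero, ← Finset.mul_sum]
    rw [← ofReal_sum, hsum]
    simp
  -- The integrals of the `G i` live in different charts. The second factor `ρ j` localizes to the
  -- overlap of charts `i` and `j`: summing over `j` in chart `i` recovers the integral of `G i`,
  -- summing over `i` in chart `j` gives `8 κ` times the integral of `ρ j |η|²`.
  set f : Fin n → Fin n → X → ℂ := fun i j x => ρ j x * G i x with hf
  have hfzero : ∀ i j x, x ∉ (e i).source ∩ (e j).source → f i j x = 0 := by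
    intro i j x hx
    by_cases hxi : x ∈ (e i).source
    · simp [hf, hzero j x fun hxj => hx ⟨hxi, hxj⟩]
    · simp [hf, hGzero i x hxi]
  have hfint : ∀ i j, IntegrableOn (volIntegrand η (e i) (f i j)) (e i).target := by
    intro i j
    have h1 : volIntegrand η (e i) (f i j) = fun y =>
        ((ρ j ∘ (e i).symm) y : ℂ) * volIntegrand η (e i) (G i) y := by
      funext y
      simp only [volIntegrand, hf, Function.comp_apply]
      ring
    rw [h1]
    refine Integrable.bdd_mul (c := 1) (hI i).1 ?_ (Filter.Eventually.of_forall fun y => ?_)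
    · exact (continuous_ofReal.comp_continuousOn
        (contDiffOn_comp_symm (he i) (hρ j)).continuousOn).aestronglyMeasurable
          (e i).open_target.measurableSet
    · rw [Function.comp_apply, norm_real, Real.norm_of_nonneg (hnn _ _), ← hsum ((e i).symm y)]
      exact Finset.single_le_sum (fun k _ => hnn k _) (Finset.mem_univ j)
  have hcv := fun i j => volIntegrand_change_of_variables (η := η) (he i) (he j) (hfzero i j)
  have hfint' : ∀ i j, IntegrableOn (volIntegrand η (e j) (f i j)) (e j).target := fun i j =>
    (hcv i j).1 (hfint i j)
  have hsum₁ : ∀ i, ∑ j, ∫ y in (e i).target, volIntegrand η (e i) (f i j) y = 0 := by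
    intro i
    rw [← integral_finsetSum _ fun j _ => hfint i j, ← (hI i).2]
    congr 1
    funext y
    simp only [volIntegrand, hf]
    rw [← Finset.mul_sum, ← Finset.sum_mul, ← ofReal_sum, hsum]
    simp
  have hsum₂' : ∀ j y, ∑ i, volIntegrand η (e j) (f i j) y =
      8 * κ * ((normSq (η.coeffIn (e j) y) * ρ j ((e j).symm y) : ℝ) : ℂ) := by
    intro j y
    simp only [volIntegrand, hf]
    rw [← Finset.mul_sum, ← Finset.mul_sum, hGsum]
    push_cast
    ring
  have hsum₂ : ∀ j, ∑ i, ∫ y in (e j).target, volIntegrand η (e j) (f i j) y =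
      8 * κ * ((∫ y in (e j).target,
        normSq (η.coeffIn (e j) y) * ρ j ((e j).symm y) : ℝ) : ℂ) := by
    intro j
    rw [← integral_finsetSum _ fun i _ => hfint' i j]
    simp only [hsum₂']
    rw [integral_const_mul, integral_complex_ofReal]
  -- Exchanging the two summations gives `8 κ` times the total volume of `|η|²` on one side and 0 on
  -- the other.
  have htotal : 8 * κ * ((∑ j, ∫ y in (e j).target,
      normSq (η.coeffIn (e j) y) * ρ j ((e j).symm y) : ℝ) : ℂ) = 0 := by
    rw [ofReal_sum, Finset.mul_sum, ← Finset.sum_congr rfl fun j _ => hsum₂ j, Finset.sum_comm]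
    refine Finset.sum_eq_zero fun i _ => ?_
    rw [← hsum₁ i]
    exact Finset.sum_congr rfl fun j _ => ((hcv i j).2).symm
  by_contra hκ
  have hpos : ∀ j y, 0 ≤ normSq (η.coeffIn (e j) y) * ρ j ((e j).symm y) := fun j y =>
    mul_nonneg (normSq_nonneg _) (hnn _ _)
  -- The integrability of `8 κ ρ j |η|²` is known from the `f i j`; as `κ` is not 0, it may be
  -- divided out.
  have hreal : ∀ j, IntegrableOn (fun y => normSq (η.coeffIn (e j) y) * ρ j ((e j).symm y))
      (e j).target := by
    intro j
    have h1 : IntegrableOn (fun y => ∑ i, volIntegrand η (e j) (f i j) y) (e j).target :=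
      integrable_finsetSum _ fun i _ => hfint' i j
    simp only [hsum₂'] at h1
    have h2 := (h1.const_mul (8 * κ)⁻¹).re
    refine h2.congr (Filter.Eventually.of_forall fun y => ?_)
    have h3 : (8 * κ)⁻¹ * (8 * κ * ((normSq (η.coeffIn (e j) y) * ρ j ((e j).symm y) : ℝ) : ℂ)) =
        ((normSq (η.coeffIn (e j) y) * ρ j ((e j).symm y) : ℝ) : ℂ) :=
      inv_mul_cancel_left₀ (by simp [hκ]) _
    simp only [h3]
    exact ofReal_re _
  have hzero' : ∑ j, ∫ y in (e j).target, normSq (η.coeffIn (e j) y) * ρ j ((e j).symm y) = 0 := by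
    have h1 : (8 : ℂ) * κ ≠ 0 := by simp [hκ]
    exact_mod_cast (mul_eq_zero.1 htotal).resolve_left h1
  have hnn' : ∀ j ∈ Finset.univ, 0 ≤ ∫ y in (e j).target,
      normSq (η.coeffIn (e j) y) * ρ j ((e j).symm y) := fun j _ => integral_nonneg (hpos j)
  obtain ⟨x⟩ := ‹Nonempty X›
  obtain ⟨j, -, hj⟩ : ∃ j ∈ Finset.univ, ρ j x ≠ 0 :=
    Finset.exists_ne_zero_of_sum_ne_zero (by rw [hsum x]; exact one_ne_zero)
  have hxj : x ∈ (e j).source := by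
    by_contra h
    exact hj (hzero j x h)
  have h1 := (Finset.sum_eq_zero_iff_of_nonneg hnn').1 hzero' j (Finset.mem_univ j)
  refine absurd h1 (ne_of_gt ?_)
  rw [setIntegral_pos_iff_support_of_nonneg_ae
    (Filter.Eventually.of_forall fun y => hpos j y) (hreal j)]
  have hopen : IsOpen ((e j).target ∩ (ρ j ∘ (e j).symm) ⁻¹' {0}ᶜ) :=
    (contDiffOn_comp_symm (he j) (hρ j)).continuousOn.isOpen_inter_preimage (e j).open_target
      isOpen_compl_singleton
  refine (hopen.measure_pos volume ⟨e j x, (e j).map_source hxj, ?_⟩).trans_le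
    (measure_mono ?_)
  · simpa [(e j).left_inv hxj] using hj
  · rintro y ⟨hy, hy'⟩
    refine ⟨mul_ne_zero ?_ hy', hy⟩
    simpa using Form.coeffIn_ne_zero h0 (he j) hy

end GlobalStokes

/-! ### Smooth subsets and their dimension -/

section SmoothSubsets

theorem exists_continuousLinearMap_ker (W : Submodule ℂ Model) :
    ∃ L : Model →L[ℂ] Model, ∀ v, v ∈ W ↔ L v = 0 := by
  obtain ⟨Q, hQ⟩ := W.exists_isCompl
  refine ⟨LinearMap.toContinuousLinearMap (Q.subtype ∘ₗ Q.projectionOnto W hQ.symm),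
    fun v => ?_⟩
  have h : v ∈ LinearMap.ker (Q.projectionOnto W hQ.symm) ↔ v ∈ W := by
    rw [Submodule.ker_projectionOnto]
  refine h.symm.trans ?_
  simp

variable {X : Type*} [TopologicalSpace X] [ChartedSpace Model X]

theorem contDiffAt_transition {e e' : OpenPartialHomeomorph X Model}
    (he : e ∈ IsManifold.maximalAtlas 𝓘(ℂ, Model) ω X)
    (he' : e' ∈ IsManifold.maximalAtlas 𝓘(ℂ, Model) ω X) {y : Model} (hy : y ∈ e.target)
    (hy' : e.symm y ∈ e'.source) : ContDiffAt ℂ ω (e' ∘ e.symm) y := by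
  rw [← contMDiffAt_iff_contDiffAt]
  exact (contMDiffAt_of_mem_maximalAtlas he' hy').comp y
    (contMDiffAt_symm_of_mem_maximalAtlas he hy)

/-- The dimension of a smooth subset is monotone. -/
theorem IsSmoothOfDimAt.le_of_subset {A B : Set X} (hAB : A ⊆ B) {d d' : ℕ} {x : X}
    (hA : IsSmoothOfDimAt A d x) (hB : IsSmoothOfDimAt B d' x) : d ≤ d' := by
  obtain ⟨-, e, he, hxe, W, hW, hAW⟩ := hA
  obtain ⟨-, e', he', hxe', W', hW', hBW⟩ := hB
  have hy : e x ∈ e.target := e.map_source hxe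
  have hy' : e' x ∈ e'.target := e'.map_source hxe'
  have hex : e.symm (e x) = x := e.left_inv hxe
  have hex' : e'.symm (e' x) = x := e'.left_inv hxe'
  have hT : DifferentiableAt ℂ (e' ∘ e.symm) (e x) :=
    (contDiffAt_transition he he' hy (by rwa [hex])).differentiableAt (by simp)
  have hS : DifferentiableAt ℂ (e ∘ e'.symm) ((e' ∘ e.symm) (e x)) := by
    rw [Function.comp_apply, hex]
    exact (contDiffAt_transition he' he hy' (by rwa [hex'])).differentiableAt (by simp)
  have hmem : ∀ᶠ z in nhds (e x), z ∈ e.target ∧ e.symm z ∈ e'.source :=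
    (e.open_target.eventually_mem hy).and
      ((e.continuousAt_symm hy).eventually_mem (e'.open_source.mem_nhds (by rwa [hex])))
  set D := fderiv ℂ (e' ∘ e.symm) (e x) with hD
  have hinj : Function.Injective D := by
    have h1 : (e ∘ e'.symm) ∘ (e' ∘ e.symm) =ᶠ[nhds (e x)] id := by
      filter_upwards [hmem] with z hz
      simp [e'.left_inv hz.2, e.right_inv hz.1]
    have h2 := (hS.hasFDerivAt.comp (e x) hT.hasFDerivAt).fderiv
    rw [h1.fderiv_eq, fderiv_id] at h2
    refine Function.LeftInverse.injective
      (g := fderiv ℂ (e ∘ e'.symm) ((e' ∘ e.symm) (e x))) fun v => ?_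
    exact (congrArg (fun M : Model →L[ℂ] Model => M v) h2).symm
  obtain ⟨L, hL⟩ := exists_continuousLinearMap_ker W'
  -- A short segment from `e x` in a direction of `W` stays in `A`, hence in `B`, so its image in
  -- the other chart stays in `e' x + W'`. Differentiating at 0 puts the tangent vector into `W'`.
  have hDW : W.map (D : Model →ₗ[ℂ] Model) ≤ W' := by
    rintro _ ⟨w, hw, rfl⟩
    have hline : HasDerivAt (fun s : ℂ => e x + s • w) w 0 := by
      simpa using ((hasDerivAt_id (0 : ℂ)).smul_const w).const_add (e x)
    have hT' : HasFDerivAt (e' ∘ e.symm) D (e x + (0 : ℂ) • w) := by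
      simpa using hT.hasFDerivAt
    have h1 : HasDerivAt (fun s : ℂ => L ((e' ∘ e.symm) (e x + s • w) - e' x)) (L (D w)) 0 :=
      L.hasFDerivAt.comp_hasDerivAt (0 : ℂ) ((hT'.comp_hasDerivAt (0 : ℂ) hline).sub_const _)
    have h2 : (fun s : ℂ => L ((e' ∘ e.symm) (e x + s • w) - e' x)) =ᶠ[nhds 0] fun _ => 0 := by
      have h3 : Filter.Tendsto (fun s : ℂ => e x + s • w) (nhds 0) (nhds (e x)) := by
        simpa using hline.continuousAt.tendsto
      filter_upwards [h3.eventually hmem] with s hs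
      refine (hL _).1 ((hBW _ hs.2).1 (hAB ((hAW _ (e.map_target hs.1)).2 ?_)))
      rw [e.right_inv hs.1, add_sub_cancel_left]
      exact W.smul_mem s hw
    rw [ContinuousLinearMap.coe_coe, hL]
    exact h1.unique ((hasDerivAt_const (0 : ℂ) (0 : Model)).congr_of_eventuallyEq h2)
  rw [← hW, ← hW', (Submodule.equivMapOfInjective (D : Model →ₗ[ℂ] Model) hinj W).finrank_eq]
  exact Submodule.finrank_mono hDW

/-- A closed subset of a connected manifold that is smooth at each of its points and contains an
open set is the whole manifold. -/
theorem eq_univ_of_isSmoothOfDimAt [PreconnectedSpace X] {A : Set X} (hA : IsClosed A)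
    (hsm : ∀ x ∈ A, ∃ d, IsSmoothOfDimAt A d x) {x : X} (hx : IsSmoothOfDimAt A 3 x) :
    A = Set.univ := by
  have hopen : ∀ (e : OpenPartialHomeomorph X Model) (W : Submodule ℂ Model) (z : X),
      z ∈ e.source → (∀ y ∈ e.source, y ∈ A ↔ e y - e z ∈ W) → W = ⊤ → z ∈ interior A := by
    rintro e W z hz hAW rfl
    exact mem_interior.2 ⟨e.source, fun y hy => (hAW y hy).2 trivial, e.open_source, hz⟩
  have hclopen : IsClopen (interior A) := by
    refine ⟨isClosed_of_closure_subset fun z hz => ?_, isOpen_interior⟩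
    have hzA : z ∈ A := hA.closure_subset_iff.2 interior_subset hz
    obtain ⟨d, -, e, -, hze, W, -, hAW⟩ := hsm z hzA
    obtain ⟨y, hye, hyA⟩ := mem_closure_iff.1 hz e.source e.open_source hze
    -- Near a limit point `z` of the interior take an interior point `y`. A small nonzero step `s •
    -- v` from `y` remains in `A`, and the difference of the two positions shows `s • v ∈ W`.
    refine hopen e W z hze hAW (Submodule.eq_top_iff'.2 fun v => ?_)
    have hy : e y ∈ e.target := e.map_source hye
    have hc : Filter.Tendsto (fun s : ℂ => e.symm (e y + s • v)) (nhds 0) (nhds y) := by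
      have h1 : Filter.Tendsto (fun s : ℂ => e y + s • v) (nhds 0) (nhds (e y)) :=
        Continuous.tendsto' (by fun_prop) _ _ (by simp)
      have h2 := (e.continuousAt_symm hy).tendsto.comp h1
      rwa [e.left_inv hye] at h2
    have ht : ∀ᶠ s : ℂ in nhds 0, e y + s • v ∈ e.target :=
      (Continuous.tendsto' (by fun_prop) _ _ (by simp) :
        Filter.Tendsto (fun s : ℂ => e y + s • v) (nhds 0) (nhds (e y))).eventually_mem
          (e.open_target.mem_nhds hy)
    have hev := (hc.eventually_mem (isOpen_interior.mem_nhds hyA)).and ht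
    obtain ⟨s, hs, hs0⟩ := ((hev.filter_mono nhdsWithin_le_nhds).and
      (self_mem_nhdsWithin : ∀ᶠ s : ℂ in nhdsWithin 0 {0}ᶜ, s ∈ ({0}ᶜ : Set ℂ))).exists
    have h1 := (hAW y hye).1 (interior_subset hyA)
    have h2 := (hAW _ (e.map_target hs.2)).1 (interior_subset hs.1)
    rw [e.right_inv hs.2] at h2
    have h3 := W.sub_mem h2 h1
    have h4 : e y + s • v - e z - (e y - e z) = s • v := by abel
    rw [h4] at h3
    exact (W.smul_mem_iff hs0).1 h3
  obtain ⟨hxA, e, -, hxe, W, hW, hAW⟩ := hx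
  have hWt : W = ⊤ := Submodule.eq_top_of_finrank_eq (by simpa using hW)
  rcases isClopen_iff.1 hclopen with h | h
  · exact absurd (hopen e W x hxe hAW hWt) (by simp [h])
  · exact Set.eq_univ_of_univ_subset (h ▸ interior_subset)

variable [IsManifold 𝓘(ℂ, Model) ω X]

theorem IsSmoothOfDimAt.congr_of_isOpen {A B U : Set X} (hU : IsOpen U) {d : ℕ} {x : X}
    (hx : x ∈ U) (hAB : ∀ y ∈ U, y ∈ A ↔ y ∈ B) (hA : IsSmoothOfDimAt A d x) :
    IsSmoothOfDimAt B d x := by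
  obtain ⟨hxA, e, he, hxe, W, hW, hAW⟩ := hA
  refine ⟨(hAB x hx).1 hxA, e.restrOpen U hU, ?_, ⟨hxe, hx⟩, W, hW, fun y hy => ?_⟩
  · have := (IsManifold.mem_maximalAtlas_iff_contMDiffOn e).1 he
    refine OpenPartialHomeomorph.mem_maximalAtlas_of_contMDiffOn _
      (this.1.mono fun y hy => hy.1) (this.2.mono fun y hy => ?_)
    have hy' : y ∈ (e.restrOpen U hU).target := hy
    have h1 := (e.restrOpen U hU).map_target hy'
    have h2 : y = e ((e.restrOpen U hU).symm y) := ((e.restrOpen U hU).right_inv hy').symm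
    rw [h2]
    exact e.map_source h1.1
  · rw [← hAB y hy.2]
    exact hAW y hy.1

end SmoothSubsets

/-! ### Linearization of an involution at a fixed point -/

section FixedPoints

variable {X : Type*} [TopologicalSpace X] [ChartedSpace Model X]

theorem diffAt_comp_self {g : X → X} (hg : MDifferentiable 𝓘(ℂ, Model) 𝓘(ℂ, Model) g)
    (hinv : Function.Involutive g) {P : X} (hP : g P = P) :
    diffAt g P ∘ₗ diffAt g P = LinearMap.id := by
  have h1 : HasMFDerivAt 𝓘(ℂ, Model) 𝓘(ℂ, Model) g (g P)
      (mfderiv 𝓘(ℂ, Model) 𝓘(ℂ, Model) g (g P)) := (hg (g P)).hasMFDerivAt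
  have h2 := (h1.comp P (hg P).hasMFDerivAt).mfderiv
  rw [hinv.comp_self] at h2
  have h3 := mfderiv_id.symm.trans h2
  have h4 : LinearMap.id = diffAt g (g P) ∘ₗ diffAt g P :=
    congrArg (fun A : Model →L[ℂ] Model => (A : Model →ₗ[ℂ] Model)) h3
  rw [hP] at h4
  exact h4.symm

variable [IsManifold 𝓘(ℂ, Model) ω X]

/-- Linearization of a holomorphic involution at a fixed point. -/
theorem isSmoothOfDimAt_fixedPoints {g : X → X}
    (hg : ContMDiff 𝓘(ℂ, Model) 𝓘(ℂ, Model) ω g) (hinv : Function.Involutive g) {P : X}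
    (hP : g P = P) : IsSmoothOfDimAt (Function.fixedPoints g)
      (Module.finrank ℂ (LinearMap.ker (diffAt g P - LinearMap.id))) P := by
  set e := chartAt Model P with he
  have hPe : P ∈ e.source := mem_chart_source Model P
  have hea : e ∈ IsManifold.maximalAtlas 𝓘(ℂ, Model) ω X := IsManifold.chart_mem_maximalAtlas P
  set p := e P
  have hpt : p ∈ e.target := mem_chart_target Model P
  have hep : e.symm p = P := e.left_inv hPe
  set φ := e ∘ g ∘ e.symm with hφ
  have hφp : φ p = p := by simp only [hφ, Function.comp_apply, hep, hP, p]
  have hmd : MDifferentiable 𝓘(ℂ, Model) 𝓘(ℂ, Model) g := hg.mdifferentiable (by simp)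
  set A : Model →L[ℂ] Model := mfderiv 𝓘(ℂ, Model) 𝓘(ℂ, Model) g P with hA
  have hAA : ∀ v, A (A v) = v := fun v => LinearMap.congr_fun (diffAt_comp_self hmd hinv hP) v
  have hφc : ContDiffAt ℂ ω φ p := by
    rw [← contMDiffAt_iff_contDiffAt]
    refine (contMDiffAt_of_mem_maximalAtlas hea ?_).comp p
      ((hg _).comp p (contMDiffAt_symm_of_mem_maximalAtlas hea hpt))
    rw [Function.comp_apply, hep, hP]
    exact hPe
  have hφd : HasFDerivAt φ A p := by
    have h1 := (hmd P).hasMFDerivAt.2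
    simp only [writtenInExtChartAt, extChartAt, hP, OpenPartialHomeomorph.extend_coe,
      modelWithCornersSelf_coe, OpenPartialHomeomorph.extend_coe_symm,
      modelWithCornersSelf_coe_symm, Function.id_comp, Function.comp_id, Set.range_id] at h1
    have h2 : HasFDerivWithinAt φ A Set.univ p := h1
    exact hasFDerivWithinAt_univ.1 h2
  -- This is the average of `y - p` over the group of order 2. Since `A` and `φ` are involutions, `ψ
  -- ∘ φ = A ∘ ψ`, and the derivative at `p` is `(1 + A²) / 2 = 1`, so `ψ` is a coordinate system in
  -- which `g` is linear.
  set ψ : Model → Model := fun y => (2⁻¹ : ℂ) • ((y - p) + A (φ y - p)) with hψ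
  have hψp : ψ p = 0 := by simp [hψ, hφp]
  have hψc : ContDiffAt ℂ ω ψ p :=
    ((contDiffAt_id.sub contDiffAt_const).add
      (A.contDiff.contDiffAt.comp p (hφc.sub contDiffAt_const))).const_smul _
  have hψd : HasFDerivAt ψ ((ContinuousLinearEquiv.refl ℂ Model : Model ≃L[ℂ] Model) :
      Model →L[ℂ] Model) p := by
    have h1 : HasFDerivAt ψ ((2⁻¹ : ℂ) • (ContinuousLinearMap.id ℂ Model + A.comp A)) p :=
      (((hasFDerivAt_id p).sub_const p).add
        (A.hasFDerivAt.comp p (hφd.sub_const p))).const_smul (2⁻¹ : ℂ)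
    convert h1 using 1
    ext1 v
    simp only [ContinuousLinearEquiv.coe_refl, ContinuousLinearMap.id_apply,
      smul_apply, add_apply, ContinuousLinearMap.comp_apply, hAA]
    rw [← two_smul ℂ v, smul_smul]
    norm_num
  set Ψ := hψc.toOpenPartialHomeomorph ψ hψd (by simp) with hΨ
  have hΨc : ∀ y, Ψ y = ψ y := fun y => rfl
  have hpΨ : p ∈ Ψ.source := hψc.mem_toOpenPartialHomeomorph_source hψd (by simp)
  -- Analyticity of `ψ` and invertibility of its derivative at every point make the new chart belong
  -- to the maximal atlas; `φ y ∈ Ψ.source` allows the injectivity of `ψ` to be applied to the pair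
  -- `φ y`, `y`.
  have hev : ∀ᶠ y in nhds p, (y ∈ e.target ∧ g (e.symm y) ∈ e.source) ∧ ContDiffAt ℂ ω ψ y ∧
      (∃ B : Model ≃L[ℂ] Model, (B : Model →L[ℂ] Model) = fderiv ℂ ψ y) ∧
      φ y ∈ Ψ.source := by
    refine (eventually_coordinates ?_ hpt ?_).and
      ((hψc.eventually (by simp)).and (Filter.Eventually.and ?_ ?_))
    · exact (hmd _).continuousAt
    · rwa [hep, hP]
    · have h1 : ContinuousAt (fderiv ℂ ψ) p :=
        (hψc.fderiv_right (m := ω) (by simp)).continuousAt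
      refine h1.eventually_mem (s := Set.range ((↑) : (Model ≃L[ℂ] Model) → Model →L[ℂ] Model)) ?_
      rw [hψd.fderiv]
      exact ContinuousLinearEquiv.nhds _
    · refine hφc.continuousAt.eventually_mem ?_
      rw [hφp]
      exact Ψ.open_source.mem_nhds hpΨ
  obtain ⟨O, hO, hOo, hpO⟩ := eventually_nhds_iff.1 hev
  set Ψ' := Ψ.restrOpen O hOo with hΨ'
  set ε := e.trans Ψ' with hε
  have hεs : ∀ x, x ∈ ε.source ↔ x ∈ e.source ∧ e x ∈ Ψ.source ∧ e x ∈ O := by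
    intro x
    simp [hε, hΨ']
  have hεc : ∀ x, ε x = ψ (e x) := fun x => rfl
  refine ⟨hP, ε, ?_, (hεs P).2 ⟨hPe, hpΨ, hpO⟩, _, rfl, fun x hx => ?_⟩
  · refine OpenPartialHomeomorph.mem_maximalAtlas_of_contMDiffOn _ (fun x hx => ?_)
      fun z hz => ?_
    · have hx' := (hεs x).1 hx
      have h1 : ContMDiffAt 𝓘(ℂ, Model) 𝓘(ℂ, Model) ω (ψ ∘ e) x :=
        (hO _ hx'.2.2).2.1.contMDiffAt.comp x (contMDiffAt_of_mem_maximalAtlas hea hx'.1)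
      exact h1.contMDiffWithinAt
    · have hx' := (hεs _).1 (ε.map_target hz)
      have hz1 : z ∈ Ψ'.target := by
        rw [hε, OpenPartialHomeomorph.trans_target] at hz
        exact hz.1
      have hz2 : Ψ'.symm z ∈ e.target := by
        rw [hε, OpenPartialHomeomorph.trans_target] at hz
        exact hz.2
      have hz3 : Ψ'.symm z ∈ O := (Ψ'.map_target hz1).2
      obtain ⟨-, hc, ⟨B, hB⟩, -⟩ := hO _ hz3
      have h1 : ContDiffAt ℂ ω Ψ'.symm z := by
        refine Ψ'.contDiffAt_symm (f₀' := B) hz1 ?_ hc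
        rw [hB]
        exact (hc.differentiableAt (by simp)).hasFDerivAt
      have h2 : ContMDiffAt 𝓘(ℂ, Model) 𝓘(ℂ, Model) ω (e.symm ∘ Ψ'.symm) z :=
        (contMDiffAt_symm_of_mem_maximalAtlas hea hz2).comp z h1.contMDiffAt
      exact h2.contMDiffWithinAt
  · have hx' := (hεs x).1 hx
    obtain ⟨⟨-, hgx⟩, -, -, hφx⟩ := hO _ hx'.2.2
    rw [e.left_inv hx'.1] at hgx
    have hφe : φ (e x) = e (g x) := by
      simp only [hφ, Function.comp_apply, e.left_inv hx'.1]
    have hφφ : φ (φ (e x)) = e x := by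
      rw [hφe]
      simp only [hφ, Function.comp_apply, e.left_inv hgx]
      rw [hinv x]
    have hcomm : ψ (φ (e x)) = A (ψ (e x)) := by
      simp only [hψ, hφφ, map_smul, map_add, hAA]
      rw [add_comm]
    have h0 : ε P = 0 := hψp
    rw [h0, sub_zero, hεc, LinearMap.mem_ker, LinearMap.sub_apply, LinearMap.id_apply,
      sub_eq_zero]
    change g x = x ↔ A (ψ (e x)) = ψ (e x)
    rw [← hcomm]
    constructor
    · intro h
      rw [hφe, h]
    · intro h
      have h1 : φ (e x) = e x := Ψ.injOn hφx hx'.2.1 h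
      rw [hφe] at h1
      exact e.injOn hgx hx'.1 h1

end FixedPoints

/-! ### Analytic subsets, smooth curves and irreducibility -/

section Curves

variable {X : Type*} [TopologicalSpace X] [ChartedSpace Model X]

theorem IsAnalyticSubset.isClosed {A : Set X} (hA : IsAnalyticSubset A) : IsClosed A := by
  rw [← isOpen_compl_iff, isOpen_iff_mem_nhds]
  intro x hx
  obtain ⟨U, hU, hxU, k, f, hf, hfA⟩ := hA x
  have h1 : ∃ i, f i x ≠ 0 := by
    by_contra! h
    exact hx ((hfA x hxU).2 h)
  obtain ⟨i, hi⟩ := h1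
  have h2 : ContinuousAt (f i) x := ((hf i).continuousOn).continuousAt (hU.mem_nhds hxU)
  filter_upwards [hU.mem_nhds hxU, h2.eventually_ne hi] with y hy hy' hyA
  exact hy' ((hfA y hy).1 hyA i)

/-- A closed subset that is smooth at each of its points is analytic. -/
theorem isAnalyticSubset_of_isSmooth [IsManifold 𝓘(ℂ, Model) ω X] {A : Set X} (hA : IsClosed A)
    (hsm : ∀ x ∈ A, ∃ d, IsSmoothOfDimAt A d x) : IsAnalyticSubset A := by
  intro x
  by_cases hx : x ∈ A
  · obtain ⟨d, -, e, he, hxe, W, -, hAW⟩ := hsm x hx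
    obtain ⟨L, hL⟩ := exists_continuousLinearMap_ker W
    refine ⟨e.source, e.open_source, hxe, 3, fun i y => L (e y - e x) i, fun i y hy => ?_,
      fun y hy => ?_⟩
    · have h1 : MDifferentiableAt 𝓘(ℂ, Model) 𝓘(ℂ, Model) e y :=
        (contMDiffAt_of_mem_maximalAtlas he hy).mdifferentiableAt (by simp)
      have h2 : MDifferentiableAt 𝓘(ℂ, Model) 𝓘(ℂ, ℂ) (fun v : Model => L (v - e x) i) (e y) := by
        rw [mdifferentiableAt_iff_differentiableAt]
        fun_prop
      exact (h2.comp y h1).mdifferentiableWithinAt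
    · rw [hAW y hy, hL, funext_iff]
      rfl
  · exact ⟨Aᶜ, hA.isOpen_compl, hx, 1, fun _ _ => 1, fun i => mdifferentiableOn_const,
      fun y hy => ⟨fun h => absurd h hy, fun h => absurd (h 0) one_ne_zero⟩⟩

/-- Near a smooth point of dimension one, `A` is the image of a disc under a holomorphic curve. -/
theorem IsSmoothOfDimAt.exists_disc {A : Set X} {x : X} (hA : IsSmoothOfDimAt A 1 x) {N : Set X}
    (hN : IsOpen N) (hxN : x ∈ N) :
    ∃ (U : Set X) (r : ℝ) (γ : ℂ → X), IsOpen U ∧ x ∈ U ∧ U ⊆ N ∧ A ∩ U = γ '' Metric.ball 0 r ∧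
      MDifferentiableOn 𝓘(ℂ, ℂ) 𝓘(ℂ, Model) γ (Metric.ball 0 r) := by
  obtain ⟨hxA, e, he, hxe, W, hW, hAW⟩ := hA
  obtain ⟨w, hw0, hw⟩ := finrank_eq_one_iff'.1 hW
  have hwn : 0 < ‖(w : Model)‖ := norm_pos_iff.2 fun h => hw0 (Subtype.ext h)
  have hy : e x ∈ e.target := e.map_source hxe
  have hO : IsOpen (e.target ∩ e.symm ⁻¹' N) := e.isOpen_inter_preimage_symm hN
  obtain ⟨δ, hδ, hδO⟩ := Metric.isOpen_iff.1 hO (e x) ⟨hy, by simpa [e.left_inv hxe] using hxN⟩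
  have hmem : ∀ t : ℂ, e x + t • (w : Model) ∈ Metric.ball (e x) δ ↔
      t ∈ Metric.ball (0 : ℂ) (δ / ‖(w : Model)‖) := by
    intro t
    rw [mem_ball_iff_norm, mem_ball_zero_iff, add_sub_cancel_left, norm_smul, lt_div_iff₀ hwn]
  refine ⟨e.source ∩ e ⁻¹' Metric.ball (e x) δ, δ / ‖(w : Model)‖,
    fun t => e.symm (e x + t • (w : Model)), e.isOpen_inter_preimage Metric.isOpen_ball,
    ⟨hxe, Metric.mem_ball_self hδ⟩, ?_, ?_, ?_⟩
  · rintro y ⟨hye, hyb⟩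
    have := (hδO hyb).2
    rwa [Set.mem_preimage, e.left_inv hye] at this
  · ext y
    constructor
    · rintro ⟨hyA, hye, hyb⟩
      obtain ⟨t, ht⟩ := hw ⟨e y - e x, (hAW y hye).1 hyA⟩
      have ht' : e x + t • (w : Model) = e y := by
        have := congrArg Subtype.val ht
        simp only [Submodule.coe_smul] at this
        rw [this]
        abel
      refine ⟨t, (hmem t).1 (by rwa [ht']), ?_⟩
      simp only [ht', e.left_inv hye]
    · rintro ⟨t, ht, rfl⟩
      have h1 := (hmem t).2 ht
      have h2 := (hδO h1).1
      refine ⟨(hAW _ (e.map_target h2)).2 ?_, e.map_target h2, ?_⟩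
      · rw [e.right_inv h2, add_sub_cancel_left]
        exact W.smul_mem t w.2
      · rw [Set.mem_preimage, e.right_inv h2]
        exact h1
  · intro t ht
    have h2 := (hδO ((hmem t).2 ht)).1
    have h3 : MDifferentiableAt 𝓘(ℂ, Model) 𝓘(ℂ, Model) e.symm (e x + t • (w : Model)) :=
      (contMDiffAt_symm_of_mem_maximalAtlas he h2).mdifferentiableAt (by simp)
    have h4 : MDifferentiableAt 𝓘(ℂ, ℂ) 𝓘(ℂ, Model) (fun t : ℂ => e x + t • (w : Model)) t := by
      rw [mdifferentiableAt_iff_differentiableAt]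
      fun_prop
    exact (h3.comp t h4).mdifferentiableWithinAt

theorem IsSmoothOfDimAt.exists_isPreconnected_inter {A : Set X} {x : X}
    (hA : IsSmoothOfDimAt A 1 x) : ∃ U, IsOpen U ∧ x ∈ U ∧ IsPreconnected (A ∩ U) := by
  obtain ⟨U, r, γ, hU, hxU, -, hAU, hγ⟩ := hA.exists_disc isOpen_univ (Set.mem_univ x)
  exact ⟨U, hU, hxU, hAU ▸ (convex_ball (0 : ℂ) r).isPreconnected.image _ hγ.continuousOn⟩

/-- The identity theorem for a smooth curve and an analytic subset. -/
theorem IsSmoothOfDimAt.exists_inter_subset {A D : Set X} {x : X} (hA : IsSmoothOfDimAt A 1 x)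
    (hD : IsAnalyticSubset D) : ∃ U, IsOpen U ∧ x ∈ U ∧
      ∀ V, IsOpen V → A ∩ V ⊆ D → (A ∩ U ∩ V).Nonempty → A ∩ U ⊆ D := by
  obtain ⟨N, hN, hxN, k, f, hf, hfD⟩ := hD x
  obtain ⟨U, r, γ, hU, hxU, hUN, hAU, hγ⟩ := hA.exists_disc hN hxN
  refine ⟨U, hU, hxU, fun V hV hVD => ?_⟩
  rintro ⟨y, hyAU, hyV⟩
  have hγU : ∀ t ∈ Metric.ball (0 : ℂ) r, γ t ∈ A ∩ U := fun t ht => by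
    rw [hAU]; exact ⟨t, ht, rfl⟩
  have hγN : ∀ t ∈ Metric.ball (0 : ℂ) r, γ t ∈ N := fun t ht => hUN (hγU t ht).2
  rw [hAU] at hyAU
  obtain ⟨t₀, ht₀, rfl⟩ := hyAU
  have hev : ∀ᶠ t in nhds t₀, t ∈ Metric.ball (0 : ℂ) r ∧ γ t ∈ V :=
    (Metric.isOpen_ball.eventually_mem ht₀).and
      ((hγ.continuousOn.continuousAt (Metric.isOpen_ball.mem_nhds ht₀)).eventually_mem
        (hV.mem_nhds hyV))
  have hzero : ∀ i, Set.EqOn (f i ∘ γ) 0 (Metric.ball (0 : ℂ) r) := by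
    intro i
    have h1 : MDifferentiableOn 𝓘(ℂ, ℂ) 𝓘(ℂ, ℂ) (f i ∘ γ) (Metric.ball (0 : ℂ) r) :=
      (hf i).comp hγ fun t ht => hγN t ht
    have h2 : DifferentiableOn ℂ (f i ∘ γ) (Metric.ball (0 : ℂ) r) :=
      mdifferentiableOn_iff_differentiableOn.1 h1
    refine (h2.analyticOnNhd Metric.isOpen_ball).eqOn_zero_of_preconnected_of_eventuallyEq_zero
      (convex_ball (0 : ℂ) r).isPreconnected ht₀ ?_
    filter_upwards [hev] with t ht
    exact (hfD _ (hγN t ht.1)).1 (hVD ⟨(hγU t ht.1).1, ht.2⟩) i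
  rw [hAU]
  rintro _ ⟨t, ht, rfl⟩
  exact (hfD _ (hγN t ht)).2 fun i => hzero i ht

variable [IsManifold 𝓘(ℂ, Model) ω X]

/-- If `C` is not contained in `D`, then the part of `C` outside `D` is a nonempty relatively open
set contained in `D'`. By the identity theorem the set of points near which `C` lies in `D'` is both
open and closed in `C`, so it is all of `C`. -/
theorem isIrreducibleAnalytic_of_isSmooth {C : Set X} (hC : IsClosed C) (hconn : IsConnected C)
    (hsm : ∀ x ∈ C, IsSmoothOfDimAt C 1 x) : IsIrreducibleAnalytic C := by
  refine ⟨isAnalyticSubset_of_isSmooth hC fun x hx => ⟨1, hsm x hx⟩, hconn.nonempty,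
    fun D D' hD hD' hDD' => ?_⟩
  by_cases hCD : C ⊆ D
  · exact Or.inl (hCD.antisymm (hDD' ▸ Set.subset_union_left))
  refine Or.inr (Set.Subset.antisymm ?_ (hDD' ▸ Set.subset_union_right))
  obtain ⟨q, hqC, hqD⟩ := Set.not_subset.1 hCD
  set O₁ := ⋃₀ {V : Set X | IsOpen V ∧ C ∩ V ⊆ D'} with hO₁
  -- `O₂` is disjoint from `O₁` within `C`. The identity theorem shows that the two cover `C`, so
  -- connectedness leaves no point of `C` to `O₂`.
  set O₂ := ⋃₀ {V : Set X | IsOpen V ∧ C ∩ V ∩ O₁ = ∅} with hO₂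
  have hO₁o : IsOpen O₁ := isOpen_sUnion fun V hV => hV.1
  have hO₂o : IsOpen O₂ := isOpen_sUnion fun V hV => hV.1
  have hq : q ∈ O₁ := by
    refine ⟨Dᶜ, ⟨hD.isClosed.isOpen_compl, fun y hy => ?_⟩, hqD⟩
    have h1 : y ∈ D ∪ D' := hDD' ▸ hy.1
    exact h1.resolve_left hy.2
  have hcover : C ⊆ O₁ ∪ O₂ := by
    intro x hx
    obtain ⟨U, hU, hxU, hUD⟩ := (hsm x hx).exists_inter_subset hD'
    rcases Set.eq_empty_or_nonempty (C ∩ U ∩ O₁) with h | ⟨y, hyCU, V, ⟨hV, hVD⟩, hyV⟩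
    · exact Or.inr ⟨U, ⟨hU, h⟩, hxU⟩
    · exact Or.inl ⟨U, ⟨hU, hUD V hV hVD ⟨y, hyCU, hyV⟩⟩, hxU⟩
  intro x hx
  rcases hcover hx with ⟨V, ⟨-, hV⟩, hxV⟩ | hx₂
  · exact hV ⟨hx, hxV⟩
  · obtain ⟨y, hyC, hy₁, V, ⟨-, hV⟩, hyV⟩ :=
      hconn.isPreconnected O₁ O₂ hO₁o hO₂o hcover ⟨q, hqC, hq⟩ ⟨x, hx, hx₂⟩
    exact absurd hV (Set.nonempty_iff_ne_empty.1 ⟨y, ⟨hyC, hyV⟩, hy₁⟩)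

/-- The connected components of a closed smooth subset of pure dimension one are curves. -/
theorem exists_isCurve_subset {A : Set X} (hA : IsClosed A) (hne : A.Nonempty)
    (hsm : IsSmoothOfPureDim A 1) : ∃ C, IsCurve C ∧ C ⊆ A := by
  obtain ⟨x₀, hx₀⟩ := hne
  set C := connectedComponentIn A x₀ with hC
  have hCA : C ⊆ A := connectedComponentIn_subset A x₀
  have hx₀C : x₀ ∈ C := mem_connectedComponentIn hx₀
  have hCclosed : IsClosed C := isClosed_of_closure_subset <|
    isPreconnected_connectedComponentIn.closure.subset_connectedComponentIn
      (subset_closure hx₀C) (closure_minimal hCA hA)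
  -- A smooth curve is locally connected, so the component `C` coincides with `A` near each of its
  -- points and inherits smoothness.
  have hCsm : ∀ x ∈ C, IsSmoothOfDimAt C 1 x := by
    intro x hx
    obtain ⟨U, hU, hxU, hUconn⟩ := (hsm x (hCA hx)).exists_isPreconnected_inter
    refine (hsm x (hCA hx)).congr_of_isOpen hU hxU fun y hy => ⟨fun hyA => ?_, fun h => hCA h⟩
    have h1 := hUconn.subset_connectedComponentIn ⟨hCA hx, hxU⟩ Set.inter_subset_left
    rw [← connectedComponentIn_eq hx] at h1
    exact h1 ⟨hyA, hy⟩
  refine ⟨C, ⟨isIrreducibleAnalytic_of_isSmooth hCclosed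
    (isConnected_connectedComponentIn_iff.2 hx₀) hCsm, ⟨x₀, hCsm x₀ hx₀C⟩, fun x d' hx => ?_⟩, hCA⟩
  exact hx.le_of_subset subset_rfl (hCsm x hx.1)

end Curves

/-! ### The factor c, the fixed locus and symplecticity -/

section Involution

open ComplexConjugate

variable {X : Type*} [TopologicalSpace X] [ChartedSpace Model X]

/-- At a fixed point the pullback of a form of top degree is multiplication by the determinant of
the differential, and `η` does not vanish there. -/
theorem pullback_factor_eq_det {η : Form ℂ X 3} (h0 : ∀ x, η x ≠ 0) {g : X → X} {c : ℂ}
    (hc : ∀ x, (η.pullback g) x = c • η x) {P : X} (hP : g P = P) :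
    c = LinearMap.det (diffAt g P) := by
  have h1 : (η.pullback g).coeff P = LinearMap.det (diffAt g P) * η.coeff (g P) :=
    alternating_apply_comp _ _
  have h2 : (η.pullback g).coeff P = c * η.coeff P := by
    rw [Form.coeff, hc P]
    rfl
  rw [hP, h2] at h1
  exact mul_right_cancel₀ (Form.coeff_ne_zero (h0 P)) h1

variable [IsManifold 𝓘(ℂ, Model) ω X]

/-- The dimension of the fixed locus of a small involution is determined by its action on the
holomorphic volume form. -/
theorem finrank_ker_eq [PreconnectedSpace X] [T2Space X] {g : X → X}
    (hg : ContMDiff 𝓘(ℂ, Model) 𝓘(ℂ, Model) ω g) (hinv : IsInvolution g) (hsmall : IsSmall g)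
    {P : X} (hP : g P = P) :
    Module.finrank ℂ (LinearMap.ker (diffAt g P - LinearMap.id)) =
      if LinearMap.det (diffAt g P) = 1 then 1 else 0 := by
  set A := diffAt g P with hA
  have hdet := det_of_involutive A (diffAt_comp_self (hg.mdifferentiable (by simp)) hinv.1 hP)
  set d := Module.finrank ℂ (LinearMap.ker (A - LinearMap.id)) with hd
  have hfr : Module.finrank ℂ Model = 3 := by simp
  have hrank : Module.finrank ℂ (LinearMap.range (A - LinearMap.id)) + d = 3 := by
    exact (LinearMap.finrank_range_add_finrank_ker (A - LinearMap.id)).trans hfr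
  -- By rank-nullity `d = 2` would make the differential of `g` itself, the iterate with `n = 1`, a
  -- quasi-reflection.
  have h2 : d ≠ 2 := by
    intro h
    have h1 := hsmall 1 P (by simpa using hP)
    rw [Function.iterate_one] at h1
    refine h1 ?_
    have h3 : Module.finrank ℂ (LinearMap.range (A - LinearMap.id)) = 1 := by omega
    rw [IsQuasiReflection, LinearMap.rank, ← Module.finrank_eq_rank, h3, Nat.cast_one]
  -- Otherwise the fixed locus would contain an open set, hence be all of `X`, and `g` would be the
  -- identity.
  have h3 : d ≠ 3 := by
    intro h
    have hsm : ∀ x ∈ Function.fixedPoints g, ∃ d, IsSmoothOfDimAt (Function.fixedPoints g) d x :=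
      fun x hx => ⟨_, isSmoothOfDimAt_fixedPoints hg hinv.1 hx⟩
    have hcl : IsClosed (Function.fixedPoints g) := isClosed_fixedPoints hg.continuous
    have h4 := isSmoothOfDimAt_fixedPoints hg hinv.1 hP
    rw [← hA, ← hd, h] at h4
    have h5 := eq_univ_of_isSmoothOfDimAt hcl hsm h4
    exact hinv.2 (funext fun x => (h5 ▸ Set.mem_univ x : x ∈ Function.fixedPoints g))
  -- For the two remaining values of `d` the determinant `(-1) ^ (3 - d)` is `-1` for `d = 0` and
  -- `1` for `d = 1`.
  rw [hdet, hfr]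
  have h4 : d = 0 ∨ d = 1 := by omega
  rcases h4 with h | h <;> rw [h] <;> norm_num

/-- The pullback of the conjugate of `η` differs from it by an exact form only if `g` preserves
`η`. -/
theorem factor_eq_one_of_isSymplectic [CompactSpace X] [T2Space X] [Nonempty X] {η : Form ℂ X 3}
    (hη : η.IsHolomorphic) (h0 : ∀ x, η x ≠ 0) {g : X → X}
    (hg : MDifferentiable 𝓘(ℂ, Model) 𝓘(ℂ, Model) g) {c : ℂ}
    (hc : ∀ x, (η.pullback g) x = c • η x) (h : IsSymplectic g) : c = 1 := by
  obtain ⟨β, hβ, hd⟩ := h η.conjugate hη.representsH0_conjugate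
  have h1 : η.conjugate.pullback g - η.conjugate = fun x => (conj c - 1) • η.conjugate x := by
    funext x
    have h2 : (η.pullback g).conjugate x = conj c • η.conjugate x :=
      (congrArg conjForm (hc x)).trans (conjForm_smul _ _)
    have h3 : ∀ τ : Model [⋀^Fin 3]→L[ℝ] ℂ, conj c • τ - τ = (conj c - 1) • τ :=
      fun τ => by
        ext v
        simp [sub_mul]
    rw [Form.conjugate_pullback hg, Pi.sub_apply, h2]
    exact h3 _
  rw [h1] at hd
  have h2 := eq_zero_of_hasExtDeriv hη h0 hβ hd
  have h3 := congrArg conj (sub_eq_zero.1 h2)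
  simpa using h3

end Involution

end CYThreefold

end

/-! ### The equivalence -/

theorem mainTheorem7 {X : Type*} [TopologicalSpace X] [ChartedSpace CYThreefold.Model X]
    (hX : CYThreefold.IsCalabiYauThreefold X)
    (g : Diffeomorph 𝓘(ℂ, CYThreefold.Model) 𝓘(ℂ, CYThreefold.Model) X X ω)
    (hinv : CYThreefold.IsInvolution g) (hsmall : CYThreefold.IsSmall g)
    (hfix : (Function.fixedPoints g).Nonempty) :
    List.TFAE [CYThreefold.IsSymplectic g,
      ∃ C : Set X, CYThreefold.IsCurve C ∧ C ⊆ Function.fixedPoints g,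
      CYThreefold.IsSmoothOfPureDim (Function.fixedPoints g) 1] := by
  have := hX.isManifold
  have := hX.t2
  have := hX.compact
  have := hX.connected
  obtain ⟨η, hη, h0⟩ := hX.trivialCanonical
  have hg : ContMDiff 𝓘(ℂ, CYThreefold.Model) 𝓘(ℂ, CYThreefold.Model) ω g := g.contMDiff
  have hgd : MDifferentiable 𝓘(ℂ, CYThreefold.Model) 𝓘(ℂ, CYThreefold.Model) g :=
    hg.mdifferentiable (by simp)
  obtain ⟨c, hc⟩ := CYThreefold.exists_pullback_eq_smul hη h0 hgd
  -- The factor `c` is global while the determinant is local: the dimension is therefore the same at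
  -- all fixed points.
  have hsm : ∀ P ∈ Function.fixedPoints g,
      CYThreefold.IsSmoothOfDimAt (Function.fixedPoints g) (if c = 1 then 1 else 0) P := by
    intro P hP
    have h1 := CYThreefold.isSmoothOfDimAt_fixedPoints hg hinv.1 hP
    rwa [CYThreefold.finrank_ker_eq hg hinv hsmall hP,
      ← CYThreefold.pullback_factor_eq_det h0 hc hP] at h1
  -- One smooth point of dimension 1 of some subset of the fixed locus suffices, by monotonicity of
  -- the dimension. It serves for the whole fixed locus and for a curve in it.
  have hc_of : ∀ P ∈ Function.fixedPoints g, ∀ A ⊆ Function.fixedPoints g,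
      CYThreefold.IsSmoothOfDimAt A 1 P → c = 1 := by
    intro P hP A hA h
    by_contra hne
    have h1 := h.le_of_subset hA (hsm P hP)
    rw [if_neg hne] at h1
    omega
  have h3 : c = 1 → CYThreefold.IsSmoothOfPureDim (Function.fixedPoints g) 1 := by
    intro h P hP
    simpa [h] using hsm P hP
  obtain ⟨P, hP⟩ := hfix
  tfae_have 1 → 3 := fun h =>
    h3 (CYThreefold.factor_eq_one_of_isSymplectic hη h0 hgd hc h)
  tfae_have 3 → 1 := by
    intro h
    have h1 := hc_of P hP _ subset_rfl (h P hP)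
    refine CYThreefold.isSymplectic_of_pullback_eq hη h0 hgd (funext fun x => ?_)
    rw [hc x, h1, one_smul]
  tfae_have 3 → 2 := fun h =>
    CYThreefold.exists_isCurve_subset (isClosed_fixedPoints hg.continuous) ⟨P, hP⟩ h
  tfae_have 2 → 3 := by
    rintro ⟨C, ⟨-, ⟨x, hx⟩, -⟩, hC⟩
    exact h3 (hc_of x (hC hx.1) C hC hx)
  tfae_finish
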